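/- Let $d\ge 1$, let $\nu$ be a probability distribution on $(0,\infty)$ with Laplace transform $\varphi(z)=\int_0^\infty e^{-zu}\,d\nu(u)$ ($\operatorname{Re} z\ge 0$), and fix integers $j\ge 0$, $k\ge 1$. For $\theta>0$ let $N_\theta$ denote a nonnegative integer valued random variable with probability generating function $E\,s^{N_\theta}=s^j\varphi\big((1-s^k)/\theta\big)$, $0<s<1$. A probability law on $\mathbf R^d$ is *full* if it is not supported on a proper affine subspace. A full law $\tau$ is *operator stable* if there are i.i.d. random vectors $X_1,X_2,\dots$, linear operators $A_n$ on $\mathbf R^d$ and points $b_n\in\mathbf R^d$ such that $A_n\sum_{i=1}^n(X_i-b_n)$ converges in distribution to $\tau$. A full law is *operator $\varphi$-stable* if its characteristic function is $f(t)=\varphi(-\log\omega(t))=\int_0^\infty\omega(t)^u\,d\nu(u)$ with $\omega$ the characteristic function of an operator stable law and $\log\omega$ its continuous logarithm with $\log\omega(0)=0$. (i) Let $\theta_n>0$, $\theta_n\to 0$, let $m_n\ge 0$ be integers (for instance $m_n=n$), and for each $n$ let $X_{\theta_n,1},X_{\theta_n,2},\dots$ be i.i.d. random vectors in $\mathbf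 R^d$, independent of $N_{\theta_n}$, such that $X_{\theta_n,1}+\dots+X_{\theta_n,m_n}$ converges in distribution, as $n\to\infty$, to some $U$ whose law is operator stable. If the $N_{\theta_n}$-sums $\sum_{i=1}^{N_{\theta_n}}X_{\theta_n,i}$ converge in distribution to a law other than the unit mass at the origin, then this limit law is operator $\varphi$-stable. If $\theta_n m_n\to c$ for some $c\in(0,\infty)$ (for instance $\theta_n=1/n$, $m_n=n$), then the $N_{\theta_n}$-sums do converge in distribution, and the limit law is operator $\varphi$-stable. (ii) Conversely, for every operator $\varphi$-stable law $\lambda$ on $\mathbf R^d$ there are i.i.d. random vectors $X_1,X_2,\dots$, variables $N_\theta$ ($\theta>0$) as above, each independent of $(X_i)$, linear operators $A_\theta$ on $\mathbf R^d$ and points $b_\theta\in\mathbf R^d$ such that the $N_\theta$-sums of the i.i.d. vectors $A_\theta(X_i-b_\theta)$, that is, $\sum_{i=1}^{N_\theta}A_\theta(X_i-b_\theta)$, converge in distribution to $\lambda$ as $\theta\downarrow 0$. This holds for each choice of $j\ge 0$ and $k\ge 1$. -/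

import Mathlib

open MeasureTheory ProbabilityTheory Filter Topology

noncomputable section

/-- The law `μ` on `ℝ^d` is full: it is not carried by any proper affine subspace. -/
def IsFull {d : ℕ} (μ : Measure (EuclideanSpace ℝ (Fin d))) : Prop :=
  ∀ S : AffineSubspace ℝ (EuclideanSpace ℝ (Fin d)),
    μ ((S : Set (EuclideanSpace ℝ (Fin d)))ᶜ) = 0 → S = ⊤

/-- `X 0, X 1, …` are independent, identically distributed random vectors in `ℝ^d`. -/
structure IsIID {d : ℕ} {Ω : Type*} [MeasurableSpace Ω] (P : Measure Ω)
    (X : ℕ → Ω → EuclideanSpace ℝ (Fin d)) : Prop where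
  measurable : ∀ i, Measurable (X i)
  indep : iIndepFun X P
  ident : ∀ i, IdentDistrib (X i) (X 0) P P

/-- Operator stable laws on `ℝ^d`: the full laws `τ` for which there are i.i.d. random vectors
`X 0, X 1, …`, linear operators `A n` and points `b n` such that
`A n (∑_{i < n} (X i - b n))` converges in distribution to `τ`. -/
def IsOperatorStable {d : ℕ} (τ : Measure (EuclideanSpace ℝ (Fin d)))
    [IsProbabilityMeasure τ] : Prop :=
  IsFull τ ∧
  ∃ (Ω : Type) (_ : MeasurableSpace Ω) (P : Measure Ω) (_ : IsProbabilityMeasure P)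
    (X : ℕ → Ω → EuclideanSpace ℝ (Fin d))
    (A : ℕ → EuclideanSpace ℝ (Fin d) →L[ℝ] EuclideanSpace ℝ (Fin d))
    (b : ℕ → EuclideanSpace ℝ (Fin d)),
    IsIID P X ∧
    TendstoInDistribution (fun (n : ℕ) (ω : Ω) => A n (∑ i ∈ Finset.range n, (X i ω - b n)))
      atTop (fun y : EuclideanSpace ℝ (Fin d) => y) (fun _ => P) τ

/-- The Laplace transform `φ(z) = ∫ exp (-z u) dν(u)` of a law `ν` on `(0, ∞)`; it is used for
real `z ≥ 0` and, in `φ(-log ω(t))`, for complex `z` with nonnegative real part. -/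
def laplace (ν : Measure ℝ) (z : ℂ) : ℂ := ∫ u, Complex.exp (-(z * (u : ℂ))) ∂ν

/-- Operator `φ`-stable laws on `ℝ^d`, `φ` being the Laplace transform of `ν`: the full laws with
characteristic function `φ(-log ω(t))`, where `ω` is the characteristic function of an operator
stable law `τ`. Here `-log ω` is the function `ψ` that is continuous, vanishes at the
origin and satisfies `ω = exp (-ψ)`. -/
def IsOperatorPhiStable {d : ℕ} (ν : Measure ℝ)
    (ρ : Measure (EuclideanSpace ℝ (Fin d))) : Prop :=
  IsFull ρ ∧
  ∃ (τ : Measure (EuclideanSpace ℝ (Fin d))) (_ : IsProbabilityMeasure τ)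
    (ψ : EuclideanSpace ℝ (Fin d) → ℂ),
    IsOperatorStable τ ∧ Continuous ψ ∧ ψ 0 = 0 ∧
    (∀ t, charFun τ t = Complex.exp (-ψ t)) ∧
    ∀ t, charFun ρ t = laplace ν (ψ t)

/-- The random variable `N` has the probability generating function
`E s^N = s^j φ((1 - s^k)/θ)`, `0 < s < 1`. -/
def HasPhiPGF (ν : Measure ℝ) (j k : ℕ) (θ : ℝ) {Ω : Type*} [MeasurableSpace Ω]
    (P : Measure Ω) (N : Ω → ℕ) : Prop :=
  ∀ s : ℝ, 0 < s → s < 1 →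
    ((∫ ω, s ^ N ω ∂P : ℝ) : ℂ) = (s : ℂ) ^ j * laplace ν ((1 - (s : ℂ) ^ k) / (θ : ℂ))

/-- The `N`-sum `X 0 + … + X (N - 1)`. -/
def randomSum {d : ℕ} {Ω : Type*} (X : ℕ → Ω → EuclideanSpace ℝ (Fin d)) (N : Ω → ℕ) (ω : Ω) :
    EuclideanSpace ℝ (Fin d) :=
  ∑ i ∈ Finset.range (N ω), X i ω

end

/-!
Let `f_n` be the characteristic function of the summands in row `n` and `ω = exp (-ψ)` that of the
operator stable limit, so that `f_n ^ m_n → ω`. By Wald's formula and analytic continuation of the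
generating function from `(0, 1)` to the closed unit disc, the `N_θ`-sum has characteristic function
`f ^ j φ((1 - f ^ k) / θ)` (`IsIID.charFun_randomSum`, `HasPhiPGF.integral_pow`). Everything rests
on `tendsto_mul_one_sub_charFun`: if `m_n → ∞`, then `m_n (1 - f_n) → ψ`. Hence, if
`θ_n m_n → c`, the `N_θ`-sums converge to the law with characteristic function `φ((k / c) ψ)`, which
exists by Lévy's continuity theorem. It is operator `φ`-stable because `ω ^ s` is operator stable
for every real `s > 0`: in a norming of i.i.d. sums for `ω`, use the operators and shifts of index
`⌈n / s⌉` for the sum of `n` terms (`IsOperatorStable.exists_charFun_eq_exp`). A law is full if and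
only if its characteristic function does not have modulus `1` along a whole line, which
carries fullness over from `ω` to `ω ^ s` and to `φ((k / c) ψ)`.

If only convergence of the `N_θ`-sums to some law is known, pass to a subsequence along which
`θ_n m_n` converges in `[0, ∞]`. The limit `∞` makes the `N_θ`-sums tend to `0`. The limit `0` gives
`|ω| = 1` wherever the characteristic function of the limit law is nonzero, hence near the origin,
hence everywhere by `1 - |ω (2 t)|² ≤ 4 (1 - |ω t|²)`, against fullness
(`isOperatorPhiStable_of_tendsto`).

Conversely, for `θ ↓ 0` an operator `φ`-stable law arises from the i.i.d. vectors behind `ω`,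
normed with index `⌈k / θ⌉`, and from `N_θ = j + k M` with `M` mixed Poisson of parameter `U / θ`,
where `U` has law `ν` (`exists_hasPhiPGF`, `exists_randomSum_tendsto`).
-/

/-! ### Characteristic functions, fullness and weak convergence -/

section CharFun

variable {E : Type*} [NormedAddCommGroup E] [InnerProductSpace ℝ E] [MeasurableSpace E]
  [BorelSpace E]

theorem re_charFun [SecondCountableTopology E] (μ : Measure E) [IsProbabilityMeasure μ] (t : E) :
    (charFun μ t).re = ∫ x, Real.cos (inner ℝ x t) ∂μ := by
  have hint : Integrable (fun x => Complex.exp (inner ℝ x t * Complex.I)) μ := by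
    refine Integrable.of_bound (by fun_prop) 1 (ae_of_all _ fun x => ?_)
    rw [Complex.norm_exp_ofReal_mul_I]
  rw [charFun_apply]
  have := integral_re hint
  simp only [RCLike.re_to_complex] at this
  rw [← this]
  congr 1 with x
  rw [Complex.exp_ofReal_mul_I_re]

theorem one_sub_re_charFun_two_smul_le [SecondCountableTopology E] (μ : Measure E)
    [IsProbabilityMeasure μ] (t : E) :
    1 - (charFun μ ((2 : ℝ) • t)).re ≤ 4 * (1 - (charFun μ t).re) := by
  have hint (s : E) : Integrable (fun x => Real.cos (inner ℝ x s)) μ :=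
    Integrable.of_bound (by fun_prop) 1 (ae_of_all _ fun x => Real.abs_cos_le_one _)
  have h1 (s : E) : 1 - (charFun μ s).re = ∫ x, (1 - Real.cos (inner ℝ x s)) ∂μ := by
    rw [re_charFun, integral_sub (integrable_const _) (hint s)]
    simp
  rw [h1, h1, ← integral_const_mul]
  refine integral_mono ((integrable_const _).sub (hint _))
    (((integrable_const _).sub (hint _)).const_mul _) fun x => ?_
  simp only [inner_smul_right, Real.cos_two_mul]
  nlinarith [sq_nonneg (Real.cos (inner ℝ x t) - 1)]

/-- The inequality of `one_sub_re_charFun_two_smul_le` for the symmetrization of `μ`, whose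
characteristic function is `|charFun μ|²`. -/
theorem one_sub_norm_sq_charFun_two_smul_le [SecondCountableTopology E] (μ : Measure E)
    [IsProbabilityMeasure μ] (t : E) :
    1 - ‖charFun μ ((2 : ℝ) • t)‖ ^ 2 ≤ 4 * (1 - ‖charFun μ t‖ ^ 2) := by
  have hprob : IsProbabilityMeasure (μ.map fun x => (-1 : ℝ) • x) :=
    Measure.isProbabilityMeasure_map (by fun_prop)
  have h (s : E) : (charFun (μ ∗ μ.map fun x => (-1 : ℝ) • x) s).re = ‖charFun μ s‖ ^ 2 := by
    rw [charFun_conv, charFun_map_smul, neg_one_smul, charFun_neg, Complex.mul_conj,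
      Complex.ofReal_re, Complex.normSq_eq_norm_sq]
  simpa only [h] using one_sub_re_charFun_two_smul_le (μ ∗ μ.map fun x => (-1 : ℝ) • x) t

/-- A property that holds near the origin and passes from `t` to `2 t` holds everywhere. -/
theorem forall_of_eventually_of_two_smul {F : Type*} [NormedAddCommGroup F] [NormedSpace ℝ F]
    {p : F → Prop} (h0 : ∀ᶠ t in 𝓝 0, p t) (h2 : ∀ t, p t → p ((2 : ℝ) • t)) (t : F) : p t := by
  have hlim : Tendsto (fun n : ℕ => ((2 : ℝ)⁻¹ ^ n) • t) atTop (𝓝 0) := by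
    have := (tendsto_pow_atTop_nhds_zero_of_lt_one (r := (2 : ℝ)⁻¹) (by norm_num)
      (by norm_num)).smul_const t
    rwa [zero_smul] at this
  obtain ⟨n, hn⟩ := (hlim.eventually h0).exists
  have key (m : ℕ) (s : F) (hs : p s) : p ((2 : ℝ) ^ m • s) := by
    induction m with
    | zero => simpa using hs
    | succ m ih => rw [pow_succ', mul_smul]; exact h2 _ ih
  have := key n _ hn
  rwa [smul_smul, ← mul_pow, mul_inv_cancel₀ (by norm_num), one_pow, one_smul] at this

/-- A characteristic function that has modulus `1` near the origin has modulus `1` everywhere. -/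
theorem norm_charFun_eq_one_of_eventually [SecondCountableTopology E] (μ : Measure E)
    [IsProbabilityMeasure μ] (h : ∀ᶠ t in 𝓝 0, ‖charFun μ t‖ = 1) (t : E) :
    ‖charFun μ t‖ = 1 := by
  refine forall_of_eventually_of_two_smul (p := fun t => ‖charFun μ t‖ = 1) h (fun s hs => ?_) t
  have h1 := one_sub_norm_sq_charFun_two_smul_le μ s
  have h2 := norm_charFun_le_one (μ := μ) ((2 : ℝ) • s)
  rw [hs] at h1
  nlinarith [norm_nonneg (charFun μ ((2 : ℝ) • s))]

omit [BorelSpace E] in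
/-- If the characteristic function of `μ` has modulus `1` all along the line through `t`, then
`⟪x, t⟫` is `μ`-almost surely constant. -/
theorem exists_ae_inner_eq_of_norm_charFun_eq_one [SecondCountableTopology E] (μ : Measure E)
    [IsProbabilityMeasure μ] (t : E) (h : ∀ u : ℝ, ‖charFun μ (u • t)‖ = 1) :
    ∃ a : ℝ, ∀ᵐ x ∂μ, inner ℝ x t = a := by
  -- Strict convexity of the disc makes each `exp (i u ⟪x, t⟫)` almost surely constant.
  have hc (u : ℝ) : ∃ c : ℂ, ∀ᵐ x ∂μ, Complex.exp (((u * inner ℝ x t : ℝ) : ℂ) * Complex.I) = c := by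
    have h1 := ae_eq_const_or_norm_integral_lt_of_norm_le_const (μ := μ) (C := 1)
      (f := fun x => Complex.exp (((u * inner ℝ x t : ℝ) : ℂ) * Complex.I))
      (ae_of_all _ fun x => by rw [Complex.norm_exp_ofReal_mul_I])
    rcases h1 with h1 | h1
    · exact ⟨_, h1⟩
    · have h2 := h u
      rw [charFun_apply] at h2
      simp only [inner_smul_right] at h2
      rw [h2] at h1
      simp at h1
  choose c hc using fun n : ℕ => hc (((n : ℝ) + 1)⁻¹)
  have hall : ∀ᵐ x ∂μ, ∀ n : ℕ,
      Complex.exp (((((n : ℝ) + 1)⁻¹ * inner ℝ x t : ℝ) : ℂ) * Complex.I) = c n :=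
    ae_all_iff.2 hc
  obtain ⟨y, hy⟩ := hall.exists
  refine ⟨inner ℝ y t, hall.mono fun x hx => ?_⟩
  -- Two values `p`, `q` of `⟪x, t⟫` satisfy `p - q ∈ 2π(n+1)ℤ` for every `n`.
  obtain ⟨n, hn⟩ := exists_nat_gt |inner ℝ x t - inner ℝ y t|
  have h1 := (hx n).trans (hy n).symm
  obtain ⟨z, hz⟩ := Complex.exp_eq_exp_iff_exists_int.1 h1
  have h2 : ((n : ℝ) + 1)⁻¹ * inner ℝ x t = ((n : ℝ) + 1)⁻¹ * inner ℝ y t + z * (2 * Real.pi) := by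
    apply Complex.ofReal_injective
    apply mul_right_cancel₀ Complex.I_ne_zero
    rw [hz]
    push_cast
    ring
  have hn1 : (0 : ℝ) < n + 1 := by positivity
  have h3 : inner ℝ x t - inner ℝ y t = (n + 1) * (z * (2 * Real.pi)) := by
    field_simp at h2
    linarith
  rcases eq_or_ne z 0 with rfl | hz0
  · simp at h3; linarith
  · exfalso
    have hz1 : (1 : ℝ) ≤ |(z : ℝ)| := by exact_mod_cast Int.one_le_abs hz0
    rw [h3, abs_mul, abs_mul, abs_of_pos hn1, abs_of_pos Real.two_pi_pos] at hn
    have : (1 : ℝ) ≤ |(z : ℝ)| * (2 * Real.pi) := by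
      nlinarith [Real.pi_gt_three]
    nlinarith

omit [BorelSpace E] in
theorem norm_charFun_smul_eq_one_of_ae_inner_eq (μ : Measure E) [IsProbabilityMeasure μ] {t : E}
    {a : ℝ} (h : ∀ᵐ x ∂μ, inner ℝ x t = a) (u : ℝ) : ‖charFun μ (u • t)‖ = 1 := by
  have h1 : charFun μ (u • t) = ∫ _, Complex.exp (((u * a : ℝ) : ℂ) * Complex.I) ∂μ := by
    rw [charFun_apply]
    refine integral_congr_ae (h.mono fun x hx => ?_)
    simp only [inner_smul_right, hx]
  rw [h1, integral_const, probReal_univ, one_smul, Complex.norm_exp_ofReal_mul_I]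

end CharFun

section Full

variable {d : ℕ}

theorem IsFull.exists_norm_charFun_ne_one {μ : Measure (EuclideanSpace ℝ (Fin d))}
    [IsProbabilityMeasure μ] (h : IsFull μ) {t : EuclideanSpace ℝ (Fin d)} (ht : t ≠ 0) :
    ∃ u : ℝ, ‖charFun μ (u • t)‖ ≠ 1 := by
  by_contra! hcon
  obtain ⟨a, ha⟩ := exists_ae_inner_eq_of_norm_charFun_eq_one μ t hcon
  obtain ⟨y, hy⟩ := ha.exists
  have hS := h (AffineSubspace.mk' y (LinearMap.ker (innerₛₗ ℝ t))) (by
    refine ae_iff.1 (ha.mono fun x hx => ?_)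
    simp [AffineSubspace.mem_mk', inner_sub_right, real_inner_comm x t, real_inner_comm y t, hx, hy])
  have hmem : y + t ∈ AffineSubspace.mk' y (LinearMap.ker (innerₛₗ ℝ t)) := by
    rw [hS]; exact AffineSubspace.mem_top _ _ _
  simp [AffineSubspace.mem_mk'] at hmem
  exact ht hmem

/-- Converse of `IsFull.exists_norm_charFun_ne_one`: apply the hypothesis to a normal vector of a
proper affine subspace. -/
theorem isFull_of_exists_norm_charFun_ne_one {μ : Measure (EuclideanSpace ℝ (Fin d))}
    [IsProbabilityMeasure μ]
    (h : ∀ t : EuclideanSpace ℝ (Fin d), t ≠ 0 → ∃ u : ℝ, ‖charFun μ (u • t)‖ ≠ 1) :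
    IsFull μ := by
  intro S hS
  have hae : ∀ᵐ x ∂μ, x ∈ S := by
    rw [ae_iff]; exact hS
  obtain ⟨y, hy⟩ := hae.exists
  by_contra hne
  have hdir : S.direction ≠ ⊤ := fun htop =>
    hne ((AffineSubspace.direction_eq_top_iff_of_nonempty ⟨y, hy⟩).1 htop)
  obtain ⟨t, ht, ht0⟩ := Submodule.exists_mem_ne_zero_of_ne_bot
    (mt (Submodule.orthogonal_eq_bot_iff (K := S.direction)).1 hdir)
  obtain ⟨u, hu⟩ := h t ht0
  refine hu (norm_charFun_smul_eq_one_of_ae_inner_eq μ (a := inner ℝ y t) (hae.mono fun x hx => ?_) u)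
  have h1 := (Submodule.mem_orthogonal _ _).1 ht _ (AffineSubspace.vsub_mem_direction hx hy)
  rw [vsub_eq_sub, inner_sub_left] at h1
  linarith

end Full

section Levy

variable {E : Type*} [NormedAddCommGroup E] [InnerProductSpace ℝ E] [FiniteDimensional ℝ E]
  [MeasurableSpace E] [BorelSpace E]

/-- Lévy's continuity theorem: a pointwise limit of characteristic functions that is continuous at
the origin is a characteristic function, by tightness and Prokhorov's theorem. -/
theorem exists_charFun_eq_of_tendsto {μ : ℕ → ProbabilityMeasure E} {f : E → ℂ}
    (hf : ContinuousAt f 0) (h : ∀ t, Tendsto (fun n => charFun (μ n : Measure E) t) atTop (𝓝 (f t))) :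
    ∃ ρ : ProbabilityMeasure E, ∀ t, charFun (ρ : Measure E) t = f t := by
  have htight := isTightMeasureSet_of_tendsto_charFun (μ := fun n => (μ n : Measure E)) hf h
  have hcomp : IsCompact (closure (Set.range μ)) := by
    apply isCompact_closure_of_isTightMeasureSet
    convert htight
    ext; simp
  obtain ⟨ρ, -, hρ⟩ := hcomp.exists_mapClusterPt_of_frequently (l := atTop) (f := μ)
    (Frequently.of_forall fun n => subset_closure (Set.mem_range_self n))
  obtain ⟨U, hU, hρU⟩ := mapClusterPt_iff_ultrafilter.1 hρ
  refine ⟨ρ, fun t => tendsto_nhds_unique ?_ ((h t).mono_left hU)⟩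
  rw [ProbabilityMeasure.tendsto_iff_forall_integral_rclike_tendsto ℂ] at hρU
  simp_rw [charFun_eq_integral_innerProbChar]
  exact hρU (BoundedContinuousFunction.innerProbChar t)

omit [FiniteDimensional ℝ E] in
theorem tendsto_charFun_of_tendsto {ι : Type*} {l : Filter ι} {μ : ι → ProbabilityMeasure E}
    {ρ : ProbabilityMeasure E} (h : Tendsto μ l (𝓝 ρ)) (t : E) :
    Tendsto (fun n => charFun (μ n : Measure E) t) l (𝓝 (charFun (ρ : Measure E) t)) := by
  rw [ProbabilityMeasure.tendsto_iff_forall_integral_rclike_tendsto ℂ] at h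
  simp_rw [charFun_eq_integral_innerProbChar]
  exact h (BoundedContinuousFunction.innerProbChar t)

theorem tendsto_of_tendsto_charFun_of_isCountablyGenerated {ι : Type*} {l : Filter ι}
    [l.IsCountablyGenerated] {μ : ι → ProbabilityMeasure E} {ρ : ProbabilityMeasure E}
    (h : ∀ t, Tendsto (fun n => charFun (μ n : Measure E) t) l (𝓝 (charFun (ρ : Measure E) t))) :
    Tendsto μ l (𝓝 ρ) :=
  tendsto_of_seq_tendsto fun _ hu =>
    ProbabilityMeasure.tendsto_of_tendsto_charFun fun t => (h t).comp hu

/-- Weak convergence makes the characteristic functions converge continuously, that is, jointly in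
the index and in the argument. -/
theorem tendsto_charFun_prod {ι : Type*} {l : Filter ι} {μ : ι → ProbabilityMeasure E}
    {ρ : ProbabilityMeasure E} (h : Tendsto μ l (𝓝 ρ)) (t : E) :
    Tendsto (fun p : ι × E => charFun (μ p.1 : Measure E) p.2) (l ×ˢ 𝓝 t)
      (𝓝 (charFun (ρ : Measure E) t)) := by
  have h1 : Tendsto (fun p : ι × E => (μ p.1).prod (diracProba p.2)) (l ×ˢ 𝓝 t)
      (𝓝 (ρ.prod (diracProba t))) :=
    ((ProbabilityMeasure.continuous_prod (α := E) (β := E)).tendsto (ρ, diracProba t)).comp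
      ((h.comp tendsto_fst).prodMk_nhds ((continuous_diracProba.tendsto t).comp tendsto_snd))
  rw [ProbabilityMeasure.tendsto_iff_forall_integral_rclike_tendsto ℂ] at h1
  let g : BoundedContinuousFunction (E × E) ℂ :=
    BoundedContinuousFunction.ofNormedAddCommGroup
      (fun q => Complex.exp (inner ℝ q.1 q.2 * Complex.I)) (by fun_prop) 1
      (fun q => by rw [Complex.norm_exp_ofReal_mul_I])
  have h2 (κ : ProbabilityMeasure E) (s : E) :
      ∫ q, g q ∂(κ.prod (diracProba s) : ProbabilityMeasure (E × E)) = charFun (κ : Measure E) s := by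
    have h3 : ((κ.prod (diracProba s) : ProbabilityMeasure (E × E)) : Measure (E × E))
        = (κ : Measure E).prod (Measure.dirac s) := rfl
    rw [h3, Measure.prod_dirac, integral_map (by fun_prop) (by fun_prop), charFun_apply]
    rfl
  simpa only [h2] using h1 g

end Levy

/-! ### Triangular arrays with i.i.d. rows -/

section TriangularArray

/-- If `a ^ m` has a positive limit and `1 - b ≤ C (1 - a)`, then `b ^ m` does not tend to `0`:
`m (1 - a) ≤ -log (a ^ m)` is bounded, hence so is `m (1 - b)`. -/
theorem ne_zero_of_tendsto_pow_of_one_sub_le {a b : ℕ → ℝ} {m : ℕ → ℕ} {α β C : ℝ}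
    (hC : 0 < C)
    (hab : ∀ n, 1 - b n ≤ C * (1 - a n)) (ha0 : ∀ n, 0 ≤ a n) (hm : Tendsto m atTop atTop)
    (hα : 0 < α) (ha : Tendsto (fun n => a n ^ m n) atTop (𝓝 α))
    (hb : Tendsto (fun n => b n ^ m n) atTop (𝓝 β)) : β ≠ 0 := by
  set D : ℝ := C * (-Real.log α + 1)
  have hmR : Tendsto (fun n => (m n : ℝ)) atTop atTop := tendsto_natCast_atTop_atTop.comp hm
  have h1 : ∀ᶠ n in atTop, -Real.log (a n ^ m n) < -Real.log α + 1 :=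
    ((ha.log hα.ne').neg).eventually_lt_const (by linarith)
  have h2 : ∀ᶠ n in atTop, (1 + (-D) / m n) ^ m n ≤ b n ^ m n := by
    filter_upwards [h1, ha.eventually_const_lt hα, hmR.eventually_ge_atTop D,
      hmR.eventually_gt_atTop 0] with n hn hpos hD hm0
    have hm0' : m n ≠ 0 := by
      rintro h; simp [h] at hm0
    have ha' : 0 < a n := by
      refine lt_of_le_of_ne (ha0 n) fun h => ?_
      rw [← h, zero_pow hm0'] at hpos
      exact lt_irrefl _ hpos
    rw [Real.log_pow] at hn
    have hlog := Real.log_le_sub_one_of_pos ha'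
    have h3 : m n * (1 - a n) ≤ -Real.log α + 1 := by nlinarith
    have h4 : m n * (1 - b n) ≤ D := by
      calc m n * (1 - b n) ≤ m n * (C * (1 - a n)) := by gcongr; exact hab n
        _ = C * (m n * (1 - a n)) := by ring
        _ ≤ D := mul_le_mul_of_nonneg_left h3 hC.le
    refine pow_le_pow_left₀ ?_ ?_ _
    · have : D / m n ≤ 1 := (div_le_one hm0).2 hD
      rw [neg_div]; linarith
    · have : 1 - b n ≤ D / m n := by rw [le_div_iff₀ hm0]; linarith
      rw [neg_div]; linarith
  have h3 := le_of_tendsto_of_tendsto ((Real.tendsto_one_add_div_pow_exp (-D)).comp hm) hb h2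
  exact ((Real.exp_pos _).trans_le h3).ne'

theorem tendsto_mul_exp_div_sub_one {ι : Type*} {l : Filter ι} {x : ι → ℂ} {y : ℂ} {m : ι → ℝ}
    (hx : Tendsto x l (𝓝 y)) (hm : Tendsto m l atTop) :
    Tendsto (fun n => (m n : ℂ) * (Complex.exp (x n / m n) - 1)) l (𝓝 y) := by
  have h0 : Tendsto (fun n => ‖x n‖ ^ 2 / m n) l (𝓝 0) :=
    (hx.norm.pow 2).div_atTop hm
  have h1 : Tendsto (fun n => ‖x n‖ / m n) l (𝓝 0) := hx.norm.div_atTop hm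
  have h2 : Tendsto (fun n => (m n : ℂ) * (Complex.exp (x n / m n) - 1) - x n) l (𝓝 0) := by
    refine squeeze_zero_norm' ?_ h0
    filter_upwards [hm.eventually_gt_atTop 0, h1.eventually_le_const one_pos] with n hn hn1
    have hnC : (m n : ℂ) ≠ 0 := by exact_mod_cast hn.ne'
    have hnorm : ‖x n / m n‖ = ‖x n‖ / m n := by
      rw [norm_div, Complex.norm_real, Real.norm_of_nonneg hn.le]
    have h3 := Complex.norm_exp_sub_one_sub_id_le (x := x n / m n) (hnorm ▸ hn1)
    rw [hnorm] at h3
    have h4 : (m n : ℂ) * (Complex.exp (x n / m n) - 1) - x n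
        = m n * (Complex.exp (x n / m n) - 1 - x n / m n) := by
      field_simp
    rw [h4, norm_mul, Complex.norm_real, Real.norm_of_nonneg hn.le]
    calc m n * ‖Complex.exp (x n / m n) - 1 - x n / m n‖ ≤ m n * (‖x n‖ / m n) ^ 2 := by gcongr
      _ = ‖x n‖ ^ 2 / m n := by field_simp
  simpa using h2.add hx

/-- A continuous function on a connected set takes only one value if its `m`-th power is `1`. -/
theorem eq_of_pow_eq_one {X : Type*} [TopologicalSpace X] {K : Set X} (hK : IsPreconnected K)
    {g : X → ℂ} (hg : ContinuousOn g K) {m : ℕ} (hm : 0 < m) (h : ∀ x ∈ K, g x ^ m = 1) {x y : X}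
    (hx : x ∈ K) (hy : y ∈ K) : g x = g y := by
  have hfin : Set.Finite {z : ℂ | z ^ m = 1} := by
    have hp := (Polynomial.X_pow_sub_C_ne_zero hm (1 : ℂ))
    refine (Polynomial.finite_setOfPred_isRoot hp).subset fun z hz => ?_
    simp only [Set.mem_ofPred_eq] at hz
    simp [Polynomial.IsRoot, hz]
  exact hK.constant_of_mapsTo hfin.isDiscrete hg h hx hy

variable {E : Type*} [NormedAddCommGroup E] [InnerProductSpace ℝ E] [FiniteDimensional ℝ E]
  [MeasurableSpace E] [BorelSpace E]
  {μ κ : ℕ → ProbabilityMeasure E} {τ : ProbabilityMeasure E} {m : ℕ → ℕ}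

/-- The limit law of row sums of a triangular array with i.i.d. rows whose lengths tend to infinity
has a characteristic function without zeros. -/
theorem charFun_ne_zero_of_tendsto
    (hκ : ∀ n t, charFun (κ n : Measure E) t = charFun (μ n : Measure E) t ^ m n)
    (hm : Tendsto m atTop atTop) (h : Tendsto κ atTop (𝓝 τ)) (t : E) :
    charFun (τ : Measure E) t ≠ 0 := by
  have hcont : Continuous (charFun (τ : Measure E)) := continuous_charFun
  have hlim (s : E) : Tendsto (fun n => (‖charFun (μ n : Measure E) s‖ ^ 2) ^ m n) atTop
      (𝓝 (‖charFun (τ : Measure E) s‖ ^ 2)) := by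
    refine ((tendsto_charFun_of_tendsto h s).norm.pow 2).congr fun n => ?_
    rw [hκ, norm_pow, ← pow_mul, ← pow_mul, mul_comm]
  refine forall_of_eventually_of_two_smul (p := fun t => charFun (τ : Measure E) t ≠ 0)
    (hcont.continuousAt.eventually_ne (by simp)) (fun s hs => ?_) t
  have h1 := ne_zero_of_tendsto_pow_of_one_sub_le (by norm_num)
    (fun n => one_sub_norm_sq_charFun_two_smul_le (μ n : Measure E) s) (fun n => sq_nonneg _) hm
    (by positivity) (hlim s) (hlim _)
  simpa using h1

omit [FiniteDimensional ℝ E] [MeasurableSpace E] [BorelSpace E] in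
theorem exists_continuous_log {f : E → ℂ} (hf : Continuous f) (h0 : f 0 = 1)
    (hne : ∀ t, f t ≠ 0) :
    ∃ ψ : E → ℂ, Continuous ψ ∧ ψ 0 = 0 ∧ ∀ t, f t = Complex.exp (-ψ t) := by
  obtain ⟨F, ⟨hF0, hF⟩, -⟩ := Complex.isCoveringMapOn_exp.existsUnique_continuousMap_lifts
    ⟨f, hf⟩ (a₀ := 0) (e₀ := 0) (by simp [h0]) hne
  refine ⟨fun t => -F t, by fun_prop, by simp [hF0], fun t => ?_⟩
  rw [neg_neg]
  exact (congrFun hF t).symm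

/-- If the row sums of a triangular array with i.i.d. rows converge weakly to a law with
characteristic function `exp (-ψ)`, then `m (1 - f) → ψ`, where `m` is the length of a row and `f`
the characteristic function of its entries. Indeed `f ^ m * exp ψ → 1` uniformly on the segment from
`0` to `t`, so that `(log (f ^ m * exp ψ) - ψ) / m` is there a continuous logarithm of `f`, up
to `m`-th roots of unity, which connectedness rules out. -/
theorem tendsto_mul_one_sub_charFun {ψ : E → ℂ}
    (hκ : ∀ n t, charFun (κ n : Measure E) t = charFun (μ n : Measure E) t ^ m n)
    (hm : Tendsto m atTop atTop) (h : Tendsto κ atTop (𝓝 τ)) (hψ : Continuous ψ) (hψ0 : ψ 0 = 0)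
    (hτ : ∀ t, charFun (τ : Measure E) t = Complex.exp (-ψ t)) (t : E) :
    Tendsto (fun n => (m n : ℂ) * (1 - charFun (μ n : Measure E) t)) atTop (𝓝 (ψ t)) := by
  set F : ℕ → E → ℂ := fun n s => charFun (κ n : Measure E) s * Complex.exp (ψ s)
  have hF (s : E) : Tendsto (fun p : ℕ × E => F p.1 p.2) (atTop ×ˢ 𝓝 s) (𝓝 1) := by
    have h1 := (tendsto_charFun_prod h s).mul
      (((Complex.continuous_exp.comp hψ).tendsto s).comp (tendsto_snd (f := (atTop : Filter ℕ))))
    rw [hτ, Function.comp_apply, ← Complex.exp_add, neg_add_cancel, Complex.exp_zero] at h1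
    exact h1
  have hunif : TendstoUniformlyOn F (fun _ => 1) atTop (segment ℝ 0 t) := by
    have hK : IsCompact (segment ℝ (0 : E) t) := by
      rw [← Path.range_segment]
      exact isCompact_range (Path.continuous _)
    refine (tendstoLocallyUniformlyOn_iff_tendstoUniformlyOn_of_compact hK).1
      (TendstoLocallyUniformly.tendstoLocallyUniformlyOn
        (tendstoLocallyUniformly_iff_forall_tendsto.2 fun s => ?_))
    exact (tendsto_const_nhds.prodMk_nhds (hF s)).mono_right (nhds_le_uniformity 1)
  have hexp : ∀ᶠ n in atTop,
      charFun (μ n : Measure E) t = Complex.exp ((Complex.log (F n t) - ψ t) / m n) := by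
    filter_upwards [Metric.tendstoUniformlyOn_iff.1 hunif 1 one_pos, hm.eventually_gt_atTop 0]
      with n hn hmn
    have hslit (s : E) (hs : s ∈ segment ℝ 0 t) : F n s ∈ Complex.slitPlane := by
      have := hn s hs
      rw [dist_comm, ← Metric.mem_ball] at this
      exact Complex.ball_one_subset_slitPlane this
    have hmC : (m n : ℂ) ≠ 0 := by exact_mod_cast hmn.ne'
    have hcμ : Continuous (charFun (μ n : Measure E)) := continuous_charFun
    have hcκ : Continuous (charFun (κ n : Measure E)) := continuous_charFun
    set g : E → ℂ := fun s =>
      charFun (μ n : Measure E) s * Complex.exp (-((Complex.log (F n s) - ψ s) / m n))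
    have hg : ContinuousOn g (segment ℝ 0 t) := by
      have hlog : ContinuousOn (fun s => Complex.log (F n s)) (segment ℝ 0 t) :=
        ContinuousOn.clog (by fun_prop) hslit
      fun_prop
    have hpow (s : E) (hs : s ∈ segment ℝ 0 t) : g s ^ m n = 1 := by
      simp only [g]
      rw [mul_pow, ← hκ, ← Complex.exp_nat_mul, mul_neg, mul_div_cancel₀ _ hmC, neg_sub,
        Complex.exp_sub, Complex.exp_log (Complex.slitPlane_ne_zero (hslit s hs))]
      rw [← mul_div_assoc]
      exact div_self (Complex.slitPlane_ne_zero (hslit s hs))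
    have h1 := eq_of_pow_eq_one (convex_segment (0 : E) t).isPreconnected hg hmn hpow
      (right_mem_segment ℝ 0 t) (left_mem_segment ℝ 0 t)
    have h2 : g 0 = 1 := by simp [g, F, hψ0]
    rw [h2] at h1
    simp only [g, Complex.exp_neg] at h1
    exact (div_eq_one_iff_eq (Complex.exp_ne_zero _)).1 h1
  have hlogF : Tendsto (fun n => Complex.log (F n t) - ψ t) atTop (𝓝 (-ψ t)) := by
    have h1 : Tendsto (fun n => F n t) atTop (𝓝 1) :=
      (hF t).comp (tendsto_id.prodMk (tendsto_const_nhds (x := t)))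
    have h2 := (h1.clog Complex.one_mem_slitPlane).sub_const (ψ t)
    simpa using h2
  have h3 := (tendsto_mul_exp_div_sub_one hlogF (tendsto_natCast_atTop_atTop.comp hm)).neg
  rw [neg_neg] at h3
  refine h3.congr' (hexp.mono fun n hn => ?_)
  simp only [Function.comp_apply, Complex.ofReal_natCast, hn]
  ring

end TriangularArray

/-! ### The Laplace transform and the generating function -/

section Laplace

variable {ν : Measure ℝ}

theorem ae_pos_of_measure_Iic_eq_zero (hν : ν (Set.Iic 0) = 0) : ∀ᵐ u ∂ν, 0 < u := by
  rw [ae_iff]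
  convert hν using 2
  ext u
  simp

theorem norm_exp_neg_mul_ofReal (z : ℂ) (u : ℝ) :
    ‖Complex.exp (-(z * (u : ℂ)))‖ = Real.exp (-(z.re * u)) := by
  simp [Complex.norm_exp]

theorem laplace_zero [IsProbabilityMeasure ν] : laplace ν 0 = 1 := by simp [laplace]

theorem tendsto_laplace [IsProbabilityMeasure ν] (hν : ν (Set.Iic 0) = 0) {ι : Type*}
    {l : Filter ι} [l.IsCountablyGenerated] {z : ι → ℂ} {z₀ : ℂ} (hz : Tendsto z l (𝓝 z₀))
    (hre : ∀ᶠ n in l, 0 ≤ (z n).re) : Tendsto (fun n => laplace ν (z n)) l (𝓝 (laplace ν z₀)) := by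
  refine tendsto_integral_filter_of_dominated_convergence (fun _ => 1)
    (Eventually.of_forall fun n => by fun_prop) ?_ (integrable_const _) ?_
  · filter_upwards [hre] with n hn
    filter_upwards [ae_pos_of_measure_Iic_eq_zero hν] with u hu
    rw [norm_exp_neg_mul_ofReal, Real.exp_le_one_iff]
    nlinarith
  · exact ae_of_all _ fun u => ((hz.mul_const _).neg).cexp

theorem tendsto_laplace_zero_of_tendsto_re_atTop [IsProbabilityMeasure ν]
    (hν : ν (Set.Iic 0) = 0) {ι : Type*} {l : Filter ι} [l.IsCountablyGenerated] {z : ι → ℂ}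
    (hz : Tendsto (fun n => (z n).re) l atTop) : Tendsto (fun n => laplace ν (z n)) l (𝓝 0) := by
  have h : Tendsto (fun n => laplace ν (z n)) l (𝓝 (∫ _, (0 : ℂ) ∂ν)) := by
    refine tendsto_integral_filter_of_dominated_convergence (fun _ => 1)
      (Eventually.of_forall fun n => by fun_prop) ?_ (integrable_const _) ?_
    · filter_upwards [hz.eventually_ge_atTop 0] with n hn
      filter_upwards [ae_pos_of_measure_Iic_eq_zero hν] with u hu
      rw [norm_exp_neg_mul_ofReal, Real.exp_le_one_iff]
      nlinarith
    · filter_upwards [ae_pos_of_measure_Iic_eq_zero hν] with u hu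
      rw [tendsto_zero_iff_norm_tendsto_zero]
      simp only [norm_exp_neg_mul_ofReal]
      exact Real.tendsto_exp_neg_atTop_nhds_zero.comp (hz.atTop_mul_const hu)
  simpa using h

theorem norm_laplace_lt_one [IsProbabilityMeasure ν] (hν : ν (Set.Iic 0) = 0) {z : ℂ}
    (hz : 0 < z.re) : ‖laplace ν z‖ < 1 := by
  have hpos := ae_pos_of_measure_Iic_eq_zero hν
  have hint : Integrable (fun u : ℝ => Real.exp (-(z.re * u))) ν :=
    Integrable.of_bound (by fun_prop) 1 (hpos.mono fun u hu => by
      rw [Real.norm_eq_abs, Real.abs_exp, Real.exp_le_one_iff]; nlinarith)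
  have h1 : ‖laplace ν z‖ ≤ ∫ u, Real.exp (-(z.re * u)) ∂ν := by
    refine (norm_integral_le_integral_norm _).trans_eq ?_
    simp only [norm_exp_neg_mul_ofReal]
  refine h1.trans_lt ?_
  have h2 : 0 < ∫ u, (1 - Real.exp (-(z.re * u))) ∂ν := by
    have hnonneg : 0 ≤ᵐ[ν] fun u => 1 - Real.exp (-(z.re * u)) := hpos.mono fun u hu => by
      simp only [Pi.zero_apply, sub_nonneg, Real.exp_le_one_iff]; nlinarith
    rw [integral_pos_iff_support_of_nonneg_ae hnonneg ((integrable_const _).sub hint)]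
    have h3 : ν (Function.support fun u => 1 - Real.exp (-(z.re * u))) = 1 := by
      refine (prob_compl_eq_zero_iff₀ ?_).1 ?_
      · exact (measurableSet_support (by fun_prop)).nullMeasurableSet
      · refine ae_iff.1 (hpos.mono fun u hu => ?_)
        have : Real.exp (-(z.re * u)) < 1 := Real.exp_lt_one_iff.2 (by nlinarith)
        simp only [Function.mem_support]
        linarith
    rw [h3]; exact one_pos
  rw [integral_sub (integrable_const _) hint] at h2
  simpa using h2

theorem laplace_eq_complexMGF (z : ℂ) : laplace ν z = complexMGF id ν (-z) := by
  simp [laplace, complexMGF]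

theorem analyticAt_laplace [IsProbabilityMeasure ν] (hν : ν (Set.Iic 0) = 0) {z : ℂ}
    (hz : 0 < z.re) : AnalyticAt ℂ (laplace ν) z := by
  have h1 : laplace ν = complexMGF id ν ∘ fun z => -z := funext laplace_eq_complexMGF
  rw [h1]
  refine AnalyticAt.comp (analyticAt_complexMGF ?_) (by fun_prop)
  refine mem_interior.2 ⟨Set.Iio 0, fun t ht => ?_, isOpen_Iio, by simpa using hz⟩
  refine Integrable.of_bound (by fun_prop) 1
    ((ae_pos_of_measure_Iic_eq_zero hν).mono fun u hu => ?_)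
  rw [Real.norm_eq_abs, Real.abs_exp, Real.exp_le_one_iff]
  exact mul_nonpos_of_nonpos_of_nonneg (le_of_lt ht) hu.le

theorem re_one_sub_pow_nonneg {s : ℂ} (hs : ‖s‖ ≤ 1) (k : ℕ) : 0 ≤ (1 - s ^ k).re := by
  have h1 : (s ^ k).re ≤ 1 := (Complex.re_le_norm _).trans (by
    rw [norm_pow]; exact pow_le_one₀ (norm_nonneg _) hs)
  rw [Complex.sub_re, Complex.one_re]; linarith

theorem re_one_sub_pow_div_nonneg {s : ℂ} (hs : ‖s‖ ≤ 1) (k : ℕ) {θ : ℝ} (hθ : 0 < θ) :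
    0 ≤ ((1 - s ^ k) / (θ : ℂ)).re := by
  rw [Complex.div_ofReal_re]
  exact div_nonneg (re_one_sub_pow_nonneg hs k) hθ.le

end Laplace

section PGF

variable {ν : Measure ℝ} [IsProbabilityMeasure ν] {j k : ℕ} {θ : ℝ} {Ω : Type*}
  [MeasurableSpace Ω] {P : Measure Ω} [IsProbabilityMeasure P] {N : Ω → ℕ}

theorem tendsto_integral_pow (hN : Measurable N) {ι : Type*} {l : Filter ι}
    [l.IsCountablyGenerated] {z : ι → ℂ} {s : ℂ} (hz : Tendsto z l (𝓝 s))
    (hz1 : ∀ n, ‖z n‖ ≤ 1) :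
    Tendsto (fun n => ∫ ω, z n ^ N ω ∂P) l (𝓝 (∫ ω, s ^ N ω ∂P)) := by
  refine tendsto_integral_filter_of_dominated_convergence (fun _ => 1)
    (Eventually.of_forall fun n => ?_) (Eventually.of_forall fun n => ae_of_all _ fun ω => ?_)
    (integrable_const _) (ae_of_all _ fun ω => hz.pow _)
  · exact (Measurable.of_discrete (f := fun i : ℕ => z n ^ i)).aestronglyMeasurable.comp_measurable hN
  · rw [norm_pow]; exact pow_le_one₀ (norm_nonneg _) (hz1 n)

/-- The formula for the probability generating function on `(0, 1)` in the exponential variable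
`s = exp z`; both sides are analytic for `Re z < 0` and agree on the negative real axis. -/
theorem HasPhiPGF.integral_exp_mul (hν : ν (Set.Iic 0) = 0) (hk : 1 ≤ k) (hθ : 0 < θ)
    (hN : Measurable N) (h : HasPhiPGF ν j k θ P N) {z : ℂ} (hz : z.re < 0) :
    ∫ ω, Complex.exp z ^ N ω ∂P
      = Complex.exp z ^ j * laplace ν ((1 - Complex.exp z ^ k) / (θ : ℂ)) := by
  set U : Set ℂ := {z | z.re < 0}
  have hnorm {w : ℂ} (hw : w ∈ U) : ‖Complex.exp w‖ < 1 := by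
    rw [Complex.norm_exp]; exact Real.exp_lt_one_iff.2 hw
  have hL : AnalyticOnNhd ℂ (fun z => ∫ ω, Complex.exp z ^ N ω ∂P) U := by
    intro w hw
    have h1 : (fun z => ∫ ω, Complex.exp z ^ N ω ∂P) = complexMGF (fun ω => (N ω : ℝ)) P := by
      ext z
      simp only [complexMGF, ← Complex.exp_nat_mul, Complex.ofReal_natCast, mul_comm]
    rw [h1]
    refine analyticAt_complexMGF (mem_interior.2 ⟨Set.Iio 0, fun t ht => ?_, isOpen_Iio, hw⟩)
    refine Integrable.of_bound (by fun_prop) 1 (ae_of_all _ fun ω => ?_)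
    rw [Real.norm_eq_abs, Real.abs_exp, Real.exp_le_one_iff]
    exact mul_nonpos_of_nonpos_of_nonneg (le_of_lt ht) (Nat.cast_nonneg _)
  have hR : AnalyticOnNhd ℂ
      (fun z => Complex.exp z ^ j * laplace ν ((1 - Complex.exp z ^ k) / (θ : ℂ))) U := by
    intro w hw
    refine AnalyticAt.mul (by fun_prop) ?_
    refine AnalyticAt.fun_comp (analyticAt_laplace hν ?_) (f := fun z => (1 - Complex.exp z ^ k) / (θ : ℂ))
      (AnalyticAt.div (by fun_prop) (by fun_prop) (by exact_mod_cast hθ.ne'))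
    rw [Complex.div_ofReal_re]
    refine div_pos ?_ hθ
    have h1 : (Complex.exp w ^ k).re < 1 := (Complex.re_le_norm _).trans_lt (by
      rw [norm_pow]; exact pow_lt_one₀ (norm_nonneg _) (hnorm hw) (by omega))
    rw [Complex.sub_re, Complex.one_re]; linarith
  refine hL.eqOn_of_preconnected_of_frequently_eq hR (convex_halfSpace_re_lt 0).isPreconnected
    (z₀ := ((-1 : ℝ) : ℂ)) (by simp [U]) ?_ hz
  have hreal : ∀ᶠ x : ℝ in 𝓝[≠] (-1), ∫ ω, Complex.exp x ^ N ω ∂P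
      = Complex.exp x ^ j * laplace ν ((1 - Complex.exp x ^ k) / (θ : ℂ)) := by
    refine eventually_nhdsWithin_of_eventually_nhds ?_
    filter_upwards [eventually_lt_nhds (show (-1 : ℝ) < 0 by norm_num)] with x hx
    have h1 := h (Real.exp x) (Real.exp_pos _) (Real.exp_lt_one_iff.2 hx)
    rw [Complex.ofReal_exp] at h1
    rw [← h1, ← integral_complex_ofReal]
    simp
  have hmap : Tendsto (fun x : ℝ => (x : ℂ)) (𝓝[≠] (-1)) (𝓝[≠] ((-1 : ℝ) : ℂ)) :=
    tendsto_nhdsWithin_iff.2 ⟨(Complex.continuous_ofReal.tendsto _).mono_left nhdsWithin_le_nhds,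
      eventually_mem_nhdsWithin.mono fun x hx => Complex.ofReal_injective.ne hx⟩
  exact hmap.frequently hreal.frequently

/-- The formula for the probability generating function, stated for `0 < s < 1`, persists on the
closed unit disc. -/
theorem HasPhiPGF.integral_pow (hν : ν (Set.Iic 0) = 0) (hk : 1 ≤ k) (hθ : 0 < θ)
    (hN : Measurable N) (h : HasPhiPGF ν j k θ P N) {s : ℂ} (hs : ‖s‖ ≤ 1) :
    ∫ ω, s ^ N ω ∂P = s ^ j * laplace ν ((1 - s ^ k) / (θ : ℂ)) := by
  have key (z : ℕ → ℂ) (hz : Tendsto z atTop (𝓝 s)) (h0 : ∀ n, z n ≠ 0) (h1 : ∀ n, ‖z n‖ < 1) :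
      ∫ ω, s ^ N ω ∂P = s ^ j * laplace ν ((1 - s ^ k) / (θ : ℂ)) := by
    have hL := tendsto_integral_pow (P := P) hN hz fun n => (h1 n).le
    have hR : Tendsto (fun n => z n ^ j * laplace ν ((1 - z n ^ k) / (θ : ℂ))) atTop
        (𝓝 (s ^ j * laplace ν ((1 - s ^ k) / (θ : ℂ)))) :=
      (hz.pow j).mul (tendsto_laplace hν (((hz.pow k).const_sub 1).div_const _)
        (Eventually.of_forall fun n => re_one_sub_pow_div_nonneg (h1 n).le k hθ))
    refine tendsto_nhds_unique hL (hR.congr fun n => ?_)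
    have h2 : (Complex.log (z n)).re < 0 := by
      rw [Complex.log_re]
      exact Real.log_neg (norm_pos_iff.2 (h0 n)) (h1 n)
    have h3 := h.integral_exp_mul hν hk hθ hN h2
    rw [Complex.exp_log (h0 n)] at h3
    exact h3.symm
  rcases eq_or_ne s 0 with rfl | hs0
  · refine key (fun n => ((1 / ((n : ℝ) + 2) : ℝ) : ℂ)) ?_ (fun n => ?_) fun n => ?_
    · have h1 : Tendsto (fun n : ℕ => 1 / ((n : ℝ) + 2)) atTop (𝓝 0) :=
        tendsto_const_nhds.div_atTop
          (tendsto_atTop_add_const_right _ _ tendsto_natCast_atTop_atTop)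
      exact (Complex.continuous_ofReal.tendsto' 0 0 (by simp)).comp h1
    · have : (0 : ℝ) < 1 / ((n : ℝ) + 2) := by positivity
      exact_mod_cast this.ne'
    · rw [Complex.norm_real, Real.norm_of_nonneg (by positivity), div_lt_one (by positivity)]
      have := Nat.cast_nonneg (α := ℝ) n
      linarith
  · have hr (n : ℕ) : 0 < 1 - 1 / ((n : ℝ) + 2) ∧ 1 - 1 / ((n : ℝ) + 2) < 1 := by
      have h1 : (0 : ℝ) < 1 / ((n : ℝ) + 2) := by positivity
      have h2 : 1 / ((n : ℝ) + 2) < 1 := by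
        rw [div_lt_one (by positivity)]
        have := Nat.cast_nonneg (α := ℝ) n
        linarith
      constructor <;> linarith
    refine key (fun n => ((1 - 1 / ((n : ℝ) + 2) : ℝ) : ℂ) * s) ?_ (fun n => ?_) fun n => ?_
    · have h1 : Tendsto (fun n : ℕ => 1 - 1 / ((n : ℝ) + 2)) atTop (𝓝 (1 - 0)) :=
        (tendsto_const_nhds.div_atTop
          (tendsto_atTop_add_const_right _ _ tendsto_natCast_atTop_atTop)).const_sub 1
      have h2 := ((Complex.continuous_ofReal.tendsto _).comp h1).mul_const s
      simpa using h2
    · exact mul_ne_zero (by exact_mod_cast (hr n).1.ne') hs0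
    · rw [norm_mul, Complex.norm_real, Real.norm_of_nonneg (hr n).1.le]
      nlinarith [(hr n).1, (hr n).2, norm_nonneg s]

omit [IsProbabilityMeasure P] in
theorem integral_pow_poissonMeasure (r : NNReal) (s : ℝ) :
    ∫ n, s ^ n ∂(poissonMeasure r) = Real.exp (-((1 - s) * r)) := by
  rw [integral_poissonMeasure]
  have h1 : HasSum (fun n : ℕ => (r * s : ℝ) ^ n / n.factorial) (Real.exp (r * s)) := by
    rw [Real.exp_eq_exp_ℝ]
    exact NormedSpace.expSeries_div_hasSum_exp (r * s : ℝ)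
  have h2 := (h1.mul_left (Real.exp (-r))).tsum_eq
  rw [← Real.exp_add] at h2
  rw [show -((1 - s) * r) = -r + r * s by ring, ← h2]
  congr 1 with n
  rw [smul_eq_mul, mul_pow]
  ring

theorem measurable_poissonMeasure : Measurable poissonMeasure := by
  refine Measure.measurable_of_measurable_coe _ fun s hs => ?_
  simp only [poissonMeasure, Measure.sum_apply _ hs, Measure.smul_apply, smul_eq_mul]
  fun_prop

omit [IsProbabilityMeasure P] in
/-- The law of `j + k M`, where `M` has the Poisson distribution with random parameter `U / θ` and
`U` has law `ν`, has probability generating function `s ^ j φ((1 - s ^ k) / θ)`. -/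
theorem exists_hasPhiPGF (hν : ν (Set.Iic 0) = 0) (j k : ℕ) (hθ : 0 < θ) :
    ∃ κ : Measure ℕ, IsProbabilityMeasure κ ∧ HasPhiPGF ν j k θ κ id := by
  set K : ℝ → Measure ℕ := fun u => poissonMeasure (u / θ).toNNReal
  have hK : Measurable K := measurable_poissonMeasure.comp (by fun_prop)
  have hprob : IsProbabilityMeasure (ν.bind K) :=
    isProbabilityMeasure_bind hK.aemeasurable (ae_of_all _ fun u => by
      simp only [K]; infer_instance)
  refine ⟨(ν.bind K).map fun n => j + k * n,
    Measure.isProbabilityMeasure_map (by fun_prop), fun s hs0 hs1 => ?_⟩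
  have hsk0 : 0 < s ^ k := pow_pos hs0 k
  have hsk1 : s ^ k ≤ 1 := pow_le_one₀ hs0.le hs1.le
  have hint : ∫ n, (s ^ k) ^ n ∂(ν.bind K) = ∫ u, Real.exp (-((1 - s ^ k) / θ * u)) ∂ν := by
    have h1 : ∫ n, (s ^ k) ^ n ∂(ν.bind K) = ∫ u, ∫ n, (s ^ k) ^ n ∂(K u) ∂ν := by
      have h2 : Integrable (fun n => (s ^ k) ^ n) (ν.bind K) :=
        Integrable.of_bound (by fun_prop) 1 (ae_of_all _ fun n => by
          rw [Real.norm_of_nonneg (by positivity)]; exact pow_le_one₀ hsk0.le hsk1)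
      exact Kernel.integral_comp (κ := Kernel.const Unit ν) (η := ⟨K, hK⟩) (a := ()) h2
    rw [h1]
    refine integral_congr_ae ((ae_pos_of_measure_Iic_eq_zero hν).mono fun u hu => ?_)
    simp only [K, integral_pow_poissonMeasure]
    rw [Real.coe_toNNReal _ (by positivity)]
    congr 1
    ring
  have h2 : ∫ n, s ^ (id n) ∂((ν.bind K).map fun n => j + k * n)
      = s ^ j * ∫ n, (s ^ k) ^ n ∂(ν.bind K) := by
    rw [integral_map (by fun_prop) (by fun_prop), ← integral_const_mul]
    simp only [id, pow_add, pow_mul]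
  rw [h2, hint, laplace, Complex.ofReal_mul, ← integral_complex_ofReal, Complex.ofReal_pow]
  push_cast
  rfl

end PGF

/-! ### Random sums -/

section RandomSum

variable {d : ℕ} {Ω : Type*} [MeasurableSpace Ω] {P : Measure Ω} [IsProbabilityMeasure P]
  {X : ℕ → Ω → EuclideanSpace ℝ (Fin d)} {N : Ω → ℕ}

omit [IsProbabilityMeasure P] in
theorem IsIID.affine (hX : IsIID P X)
    (A : EuclideanSpace ℝ (Fin d) →L[ℝ] EuclideanSpace ℝ (Fin d)) (b : EuclideanSpace ℝ (Fin d)) :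
    IsIID P fun i ω => A (X i ω - b) where
  measurable i := by
    have := hX.measurable i
    fun_prop
  indep := hX.indep.comp (fun _ x => A (x - b)) fun _ => by fun_prop
  ident i := (hX.ident i).comp (u := fun x => A (x - b)) (by fun_prop)

omit [IsProbabilityMeasure P] in
theorem IsIID.charFun_sum (hX : IsIID P X) (n : ℕ) (t : EuclideanSpace ℝ (Fin d)) :
    charFun (P.map fun ω => ∑ i ∈ Finset.range n, X i ω) t = charFun (P.map (X 0)) t ^ n := by
  rw [(hX.indep.restrict _).charFun_map_fun_finsetSum_eq_prod
    (fun i _ => (hX.measurable i).aemeasurable)]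
  simp [fun i => (hX.ident i).map_eq]

theorem measurable_sum_range :
    Measurable fun p : ℕ × (ℕ → EuclideanSpace ℝ (Fin d)) => ∑ i ∈ Finset.range p.1, p.2 i :=
  measurable_from_prod_countable_right fun n =>
    Finset.measurable_fun_sum (Finset.range n) fun i _ => measurable_pi_apply i

omit [IsProbabilityMeasure P] in
theorem IsIID.measurable_randomSum (hX : IsIID P X) (hN : Measurable N) :
    Measurable (randomSum X N) :=
  measurable_sum_range.comp (hN.prodMk (measurable_pi_lambda _ hX.measurable))

/-- Wald's formula for characteristic functions: an `N`-sum of i.i.d. vectors with characteristic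
function `f` has characteristic function `E f ^ N`. -/
theorem IsIID.charFun_randomSum (hX : IsIID P X) (hN : Measurable N)
    (hind : IndepFun N (fun ω i => X i ω) P) (t : EuclideanSpace ℝ (Fin d)) :
    charFun (P.map (randomSum X N)) t = ∫ ω, charFun (P.map (X 0)) t ^ N ω ∂P := by
  have hXm : Measurable fun ω i => X i ω := measurable_pi_lambda _ hX.measurable
  have hNp : IsProbabilityMeasure (P.map N) := Measure.isProbabilityMeasure_map hN.aemeasurable
  have hXp : IsProbabilityMeasure (P.map fun ω i => X i ω) :=
    Measure.isProbabilityMeasure_map hXm.aemeasurable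
  set G : ℕ × (ℕ → EuclideanSpace ℝ (Fin d)) → ℂ := fun p =>
    Complex.exp (inner ℝ (∑ i ∈ Finset.range p.1, p.2 i) t * Complex.I)
  have hG : Measurable G := by
    have := measurable_sum_range (d := d)
    fun_prop
  have hinner (n : ℕ) : ∫ x, G (n, x) ∂(P.map fun ω i => X i ω) = charFun (P.map (X 0)) t ^ n := by
    have hGn : Measurable fun x => G (n, x) := hG.comp measurable_prodMk_left
    rw [integral_map hXm.aemeasurable hGn.aestronglyMeasurable, ← hX.charFun_sum, charFun_apply,
      integral_map (Finset.measurable_fun_sum _ fun i _ => hX.measurable i).aemeasurable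
        (by fun_prop)]
  calc charFun (P.map (randomSum X N)) t
      = ∫ ω, G (N ω, fun i => X i ω) ∂P := by
        rw [charFun_apply, integral_map (hX.measurable_randomSum hN).aemeasurable (by fun_prop)]
        rfl
    _ = ∫ p, G p ∂(P.map fun ω => (N ω, fun i => X i ω)) := by
        rw [integral_map (hN.prodMk hXm).aemeasurable hG.aestronglyMeasurable]
    _ = ∫ n, ∫ x, G (n, x) ∂(P.map fun ω i => X i ω) ∂(P.map N) := by
        rw [hind.map_prod_eq_prod_map_map hN.aemeasurable hXm.aemeasurable, integral_prod]
        exact Integrable.of_bound hG.aestronglyMeasurable 1 (ae_of_all _ fun p => by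
          rw [Complex.norm_exp_ofReal_mul_I])
    _ = ∫ ω, charFun (P.map (X 0)) t ^ N ω ∂P := by
        simp only [hinner]
        rw [integral_map hN.aemeasurable (by fun_prop)]

end RandomSum

section Limit

variable {ν : Measure ℝ} [IsProbabilityMeasure ν] {ι : Type*} {l : Filter ι}
  [l.IsCountablyGenerated] {f : ι → ℂ} {θ m : ι → ℝ} {k : ℕ} {y : ℂ} {c : ℝ}

/-- If `m (1 - f) → y` and `1 / (θ m) → c`, then `(1 - f ^ k) / θ → c k y`, and the transform
`s ^ j φ((1 - s ^ k) / θ)` at `s = f` tends to `φ(c k y)`. -/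
theorem tendsto_pow_mul_laplace (hν : ν (Set.Iic 0) = 0) (j k : ℕ) (hf : ∀ n, ‖f n‖ ≤ 1)
    (hθ : ∀ᶠ n in l, 0 < θ n) (hm : Tendsto m l atTop)
    (hy : Tendsto (fun n => (m n : ℂ) * (1 - f n)) l (𝓝 y))
    (hc : Tendsto (fun n => (θ n * m n)⁻¹) l (𝓝 c)) :
    Tendsto (fun n => f n ^ j * laplace ν ((1 - f n ^ k) / (θ n : ℂ))) l
      (𝓝 (laplace ν (((c * k : ℝ) : ℂ) * y))) := by
  have hf1 : Tendsto f l (𝓝 1) := by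
    have h1 : Tendsto (fun n => ((m n : ℂ) * (1 - f n)) * ((m n)⁻¹ : ℝ)) l (𝓝 (y * ((0 : ℝ) : ℂ))) :=
      hy.mul ((Complex.continuous_ofReal.tendsto _).comp (tendsto_inv_atTop_zero.comp hm))
    have h2 : Tendsto (fun n => 1 - ((m n : ℂ) * (1 - f n)) * ((m n)⁻¹ : ℝ)) l (𝓝 1) := by
      simpa using h1.const_sub 1
    refine h2.congr' ?_
    filter_upwards [hm.eventually_gt_atTop 0] with n hn
    have : (m n : ℂ) ≠ 0 := by exact_mod_cast hn.ne'
    push_cast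
    field_simp
    ring
  have hsum : Tendsto (fun n => ∑ i ∈ Finset.range k, f n ^ i) l (𝓝 k) := by
    have := tendsto_finsetSum (Finset.range k) fun i _ => hf1.pow i
    simpa using this
  have hz : Tendsto (fun n => (1 - f n ^ k) / (θ n : ℂ)) l (𝓝 (((c * k : ℝ) : ℂ) * y)) := by
    have h1 := (((Complex.continuous_ofReal.tendsto _).comp hc).mul hsum).mul hy
    push_cast
    refine h1.congr' ?_
    filter_upwards [hm.eventually_gt_atTop 0, hθ] with n hn hθn
    have h2 : (m n : ℂ) ≠ 0 := by exact_mod_cast hn.ne'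
    have h3 : (θ n : ℂ) ≠ 0 := by exact_mod_cast hθn.ne'
    rw [← mul_neg_geom_sum]
    simp only [Function.comp_apply]
    push_cast
    field_simp
  have h4 := (hf1.pow j).mul (tendsto_laplace hν hz
    (hθ.mono fun n hn => re_one_sub_pow_div_nonneg (hf n) k hn))
  simpa using h4

/-- If `θ m → 0` while `f ^ m` converges and `s ^ j φ((1 - s ^ k) / θ)` at `s = f` has a nonzero
limit, then `|f ^ m| → 1`: the quotient `Re (1 - f ^ k) / θ` has to stay bounded, as `φ(z) → 0`
for `Re z → ∞`, so that `m (1 - |f| ^ k) → 0`. -/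
theorem norm_eq_one_of_tendsto_pow_of_tendsto_mul_zero {f : ℕ → ℂ} {θ : ℕ → ℝ} {m : ℕ → ℕ}
    {w r : ℂ} (hν : ν (Set.Iic 0) = 0) (j : ℕ) (hk : 1 ≤ k) (hf : ∀ n, ‖f n‖ ≤ 1)
    (hθ : ∀ n, 0 < θ n) (hθm : Tendsto (fun n => θ n * (m n : ℝ)) atTop (𝓝 0))
    (hw : Tendsto (fun n => f n ^ m n) atTop (𝓝 w)) (hr : r ≠ 0)
    (h : Tendsto (fun n => f n ^ j * laplace ν ((1 - f n ^ k) / (θ n : ℂ))) atTop (𝓝 r)) :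
    ‖w‖ = 1 := by
  have hw1 : ‖w‖ ≤ 1 := le_of_tendsto hw.norm (Eventually.of_forall fun n => by
    rw [norm_pow]; exact pow_le_one₀ (norm_nonneg _) (hf n))
  obtain ⟨R, hR⟩ : ∃ R : ℝ, ∀ z : ℂ, R ≤ z.re → ‖laplace ν z‖ < ‖r‖ / 2 := by
    have h1 := tendsto_laplace_zero_of_tendsto_re_atTop hν
      (tendsto_comap (f := Complex.re) (x := atTop))
    have h2 := h1.norm.eventually_lt_const (u := ‖r‖ / 2) (by rw [norm_zero]; positivity)
    obtain ⟨s, hs, hs'⟩ := mem_comap.1 h2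
    obtain ⟨R, hR⟩ := mem_atTop_sets.1 hs
    exact ⟨R, fun z hz => hs' (hR _ hz)⟩
  have hbd : ∀ᶠ n in atTop, m n * (1 - ‖f n‖ ^ k) ≤ θ n * m n * R := by
    filter_upwards [h.norm.eventually_const_lt (half_lt_self (norm_pos_iff.2 hr))] with n hn
    have h1 : ‖r‖ / 2 < ‖laplace ν ((1 - f n ^ k) / (θ n : ℂ))‖ := by
      refine hn.trans_le ?_
      rw [norm_mul, norm_pow]
      exact mul_le_of_le_one_left (norm_nonneg _) (pow_le_one₀ (norm_nonneg _) (hf n))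
    have h2 : (1 - (f n ^ k).re) / θ n < R := by
      have h3 : ¬ R ≤ ((1 - f n ^ k) / (θ n : ℂ)).re := fun hle => (hR _ hle).not_gt h1
      rw [Complex.div_ofReal_re, Complex.sub_re, Complex.one_re] at h3
      exact not_le.1 h3
    rw [div_lt_iff₀ (hθ n)] at h2
    have h4 : (f n ^ k).re ≤ ‖f n‖ ^ k := (Complex.re_le_norm _).trans_eq (norm_pow _ _)
    have h5 : 1 - ‖f n‖ ^ k ≤ R * θ n := by linarith
    calc m n * (1 - ‖f n‖ ^ k) ≤ m n * (R * θ n) := by gcongr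
      _ = θ n * m n * R := by ring
  have hlow : ∀ᶠ n in atTop, 1 - θ n * m n * R ≤ ‖f n ^ m n‖ ^ k := by
    filter_upwards [hbd] with n hn
    have h1 := one_add_mul_le_pow (a := ‖f n‖ ^ k - 1)
      (by have := pow_nonneg (norm_nonneg (f n)) k; linarith) (m n)
    rw [add_sub_cancel, ← pow_mul] at h1
    rw [norm_pow, ← pow_mul, mul_comm (m n) k]
    linarith
  have hlim : (1 : ℝ) ≤ ‖w‖ ^ k := by
    have h1 : Tendsto (fun n => 1 - θ n * m n * R) atTop (𝓝 1) := by
      simpa using (hθm.mul_const R).const_sub 1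
    exact le_of_tendsto_of_tendsto h1 (hw.norm.pow k) hlow
  refine le_antisymm hw1 ?_
  by_contra! hlt
  exact (pow_lt_one₀ (norm_nonneg _) hlt (by omega)).not_ge hlim

end Limit

/-! ### Operator stable laws and limits of random sums -/

section Distribution

variable {E : Type*} [NormedAddCommGroup E] [InnerProductSpace ℝ E] [FiniteDimensional ℝ E]
  [MeasurableSpace E] [BorelSpace E] {ι : Type*} {l : Filter ι} {Ω : ι → Type*}
  [∀ i, MeasurableSpace (Ω i)] {P : ∀ i, Measure (Ω i)} [∀ i, IsProbabilityMeasure (P i)]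
  {Y : ∀ i, Ω i → E} {τ : Measure E} [hτ : IsProbabilityMeasure τ]

omit [InnerProductSpace ℝ E] [FiniteDimensional ℝ E] in
theorem tendstoInDistribution_id_iff (hY : ∀ i, AEMeasurable (Y i) (P i)) :
    TendstoInDistribution Y l (fun y : E => y) P τ ↔
      Tendsto (β := ProbabilityMeasure E)
        (fun i => ⟨(P i).map (Y i), Measure.isProbabilityMeasure_map (hY i)⟩) l (𝓝 ⟨τ, hτ⟩) := by
  have h1 : (⟨τ.map (fun y : E => y), Measure.isProbabilityMeasure_map (by fun_prop)⟩ :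
      ProbabilityMeasure E) = ⟨τ, hτ⟩ := Subtype.ext Measure.map_id
  constructor
  · intro h
    have := h.tendsto
    rwa [h1] at this
  · intro h
    refine ⟨hY, by fun_prop, ?_⟩
    rwa [h1]

theorem tendstoInDistribution_id_of_tendsto_charFun [l.IsCountablyGenerated]
    (hY : ∀ i, AEMeasurable (Y i) (P i))
    (h : ∀ t, Tendsto (fun i => charFun ((P i).map (Y i)) t) l (𝓝 (charFun τ t))) :
    TendstoInDistribution Y l (fun y : E => y) P τ :=
  (tendstoInDistribution_id_iff hY).2 (tendsto_of_tendsto_charFun_of_isCountablyGenerated h)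

end Distribution

section OperatorStable

variable {d : ℕ} {τ : Measure (EuclideanSpace ℝ (Fin d))} [hτp : IsProbabilityMeasure τ]
  {ψ : EuclideanSpace ℝ (Fin d) → ℂ}

omit hτp in
theorem re_nonneg_of_charFun_eq_exp_neg [IsProbabilityMeasure τ]
    (hτ : ∀ t, charFun τ t = Complex.exp (-ψ t)) (t : EuclideanSpace ℝ (Fin d)) :
    0 ≤ (ψ t).re := by
  have h1 := norm_charFun_le_one (μ := τ) t
  rw [hτ, Complex.norm_exp, Real.exp_le_one_iff, Complex.neg_re] at h1
  linarith

theorem IsFull.exists_re_pos (h : IsFull τ) (hτ : ∀ t, charFun τ t = Complex.exp (-ψ t))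
    {t : EuclideanSpace ℝ (Fin d)} (ht : t ≠ 0) : ∃ u : ℝ, 0 < (ψ (u • t)).re := by
  obtain ⟨u, hu⟩ := h.exists_norm_charFun_ne_one ht
  refine ⟨u, lt_of_le_of_ne (re_nonneg_of_charFun_eq_exp_neg hτ _) fun h0 => hu ?_⟩
  rw [hτ, Complex.norm_exp, Complex.neg_re, ← h0, neg_zero, Real.exp_zero]

section Norming

variable {Ω : Type*} [MeasurableSpace Ω] {P : Measure Ω} [IsProbabilityMeasure P]
  {X : ℕ → Ω → EuclideanSpace ℝ (Fin d)}
  {A : ℕ → EuclideanSpace ℝ (Fin d) →L[ℝ] EuclideanSpace ℝ (Fin d)}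
  {b : ℕ → EuclideanSpace ℝ (Fin d)}

omit [IsProbabilityMeasure P] in
theorem IsIID.charFun_map_sum_affine (hX : IsIID P X)
    (A : EuclideanSpace ℝ (Fin d) →L[ℝ] EuclideanSpace ℝ (Fin d)) (b : EuclideanSpace ℝ (Fin d))
    (n : ℕ) (t : EuclideanSpace ℝ (Fin d)) :
    charFun (P.map fun ω => A (∑ i ∈ Finset.range n, (X i ω - b))) t
      = charFun (P.map fun ω => A (X 0 ω - b)) t ^ n := by
  rw [← (hX.affine A b).charFun_sum]
  simp only [map_sum]

/-- The laws of the entries and of the row sums of the triangular array `A n (X i - b n)`,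
`i < n`, attached to a norming of partial sums of i.i.d. vectors. -/
theorem IsIID.exists_laws_of_norming (hX : IsIID P X)
    (h : TendstoInDistribution
      (fun (n : ℕ) (ω : Ω) => A n (∑ i ∈ Finset.range n, (X i ω - b n))) atTop
      (fun y : EuclideanSpace ℝ (Fin d) => y) (fun _ => P) τ) :
    ∃ μ κ : ℕ → ProbabilityMeasure (EuclideanSpace ℝ (Fin d)),
      (∀ n, (μ n : Measure (EuclideanSpace ℝ (Fin d))) = P.map fun ω => A n (X 0 ω - b n)) ∧
      (∀ n t, charFun (κ n : Measure (EuclideanSpace ℝ (Fin d))) t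
        = charFun (μ n : Measure (EuclideanSpace ℝ (Fin d))) t ^ n) ∧
      Tendsto κ atTop (𝓝 ⟨τ, hτp⟩) :=
  ⟨fun n => ⟨P.map fun ω => A n (X 0 ω - b n), Measure.isProbabilityMeasure_map
      ((hX.affine (A n) (b n)).measurable 0).aemeasurable⟩,
    fun n => ⟨_, Measure.isProbabilityMeasure_map (h.forall_aemeasurable n)⟩, fun _ => rfl,
    fun n t => hX.charFun_map_sum_affine (A n) (b n) n t,
    (tendstoInDistribution_id_iff h.forall_aemeasurable).1 h⟩

theorem IsIID.tendsto_mul_one_sub_charFun_of_norming (hX : IsIID P X)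
    (h : TendstoInDistribution
      (fun (n : ℕ) (ω : Ω) => A n (∑ i ∈ Finset.range n, (X i ω - b n))) atTop
      (fun y : EuclideanSpace ℝ (Fin d) => y) (fun _ => P) τ)
    (hψ : Continuous ψ) (hψ0 : ψ 0 = 0) (hτ : ∀ t, charFun τ t = Complex.exp (-ψ t))
    (t : EuclideanSpace ℝ (Fin d)) :
    Tendsto (fun n : ℕ => (n : ℂ) * (1 - charFun (P.map fun ω => A n (X 0 ω - b n)) t)) atTop
      (𝓝 (ψ t)) := by
  obtain ⟨μ, κ, hμ, hκ, hlim⟩ := hX.exists_laws_of_norming h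
  simpa only [hμ, id] using tendsto_mul_one_sub_charFun hκ tendsto_id hlim hψ hψ0 hτ t

end Norming

theorem IsOperatorStable.exists_continuous_log (h : IsOperatorStable τ) :
    ∃ ψ : EuclideanSpace ℝ (Fin d) → ℂ,
      Continuous ψ ∧ ψ 0 = 0 ∧ ∀ t, charFun τ t = Complex.exp (-ψ t) := by
  obtain ⟨-, Ω, _, P, _, X, A, b, hX, hlim⟩ := h
  obtain ⟨μ, κ, hμ, hκ, hκlim⟩ := hX.exists_laws_of_norming hlim
  exact _root_.exists_continuous_log continuous_charFun (by simp)
    fun t => charFun_ne_zero_of_tendsto hκ tendsto_id hκlim t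

/-- The convolution powers of an operator stable law with positive real exponent `s` are operator
stable: normalize the sum of `n` vectors by the operator and the shift of index `⌈n / s⌉`. -/
theorem IsOperatorStable.exists_charFun_eq_exp (h : IsOperatorStable τ) (hψ : Continuous ψ)
    (hψ0 : ψ 0 = 0) (hτ : ∀ t, charFun τ t = Complex.exp (-ψ t)) {s : ℝ} (hs : 0 < s) :
    ∃ (τ' : Measure (EuclideanSpace ℝ (Fin d))) (_ : IsProbabilityMeasure τ'),
      IsOperatorStable τ' ∧ ∀ t, charFun τ' t = Complex.exp (-((s : ℂ) * ψ t)) := by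
  obtain ⟨hfull, Ω, _, P, _, X, A, b, hX, hlim⟩ := h
  set q : ℕ → ℕ := fun n => ⌈s⁻¹ * n⌉₊
  have hq : Tendsto q atTop atTop :=
    tendsto_nat_ceil_atTop.comp (tendsto_natCast_atTop_atTop.const_mul_atTop (inv_pos.2 hs))
  have hratio : Tendsto (fun n : ℕ => (n : ℝ) / q n) atTop (𝓝 s) := by
    have h1 : Tendsto (fun n : ℕ => (q n : ℝ) / n) atTop (𝓝 s⁻¹) :=
      (tendsto_nat_ceil_mul_div_atTop (inv_pos.2 hs).le).comp tendsto_natCast_atTop_atTop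
    simpa using h1.inv₀ (inv_pos.2 hs).ne'
  set g : ℕ → EuclideanSpace ℝ (Fin d) → ℂ := fun n =>
    charFun (P.map fun ω => A (q n) (X 0 ω - b (q n)))
  have hg (t : EuclideanSpace ℝ (Fin d)) :
      Tendsto (fun n => g n t ^ n) atTop (𝓝 (Complex.exp (-((s : ℂ) * ψ t)))) := by
    have h1 : Tendsto (fun n : ℕ => (n : ℂ) * (g n t - 1)) atTop (𝓝 (-((s : ℂ) * ψ t))) := by
      have h2 := (((Complex.continuous_ofReal.tendsto s).comp hratio).mul
        ((hX.tendsto_mul_one_sub_charFun_of_norming hlim hψ hψ0 hτ t).comp hq)).neg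
      refine h2.congr' ?_
      filter_upwards [hq.eventually_gt_atTop 0] with n hn
      have h3 : (q n : ℂ) ≠ 0 := by exact_mod_cast hn.ne'
      simp only [Function.comp_apply, g]
      push_cast
      field_simp
      ring
    simpa using Complex.tendsto_one_add_pow_exp_of_tendsto h1
  set Y : ℕ → Ω → EuclideanSpace ℝ (Fin d) := fun n ω =>
    A (q n) (∑ i ∈ Finset.range n, (X i ω - b (q n)))
  have hY (n : ℕ) : AEMeasurable (Y n) P := by
    have h1 (i : ℕ) : Measurable (X i) := hX.measurable i
    have h2 : Measurable fun ω => ∑ i ∈ Finset.range n, (X i ω - b (q n)) :=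
      Finset.measurable_fun_sum _ fun i _ => (h1 i).sub_const _
    fun_prop
  have hYlim (t : EuclideanSpace ℝ (Fin d)) :
      Tendsto (fun n => charFun (P.map (Y n)) t) atTop (𝓝 (Complex.exp (-((s : ℂ) * ψ t)))) :=
    (hg t).congr fun n => (hX.charFun_map_sum_affine (A (q n)) (b (q n)) n t).symm
  obtain ⟨⟨τ', hτ'p⟩, hτ'⟩ := exists_charFun_eq_of_tendsto
    (μ := fun n => ⟨P.map (Y n), Measure.isProbabilityMeasure_map (hY n)⟩)
    (by fun_prop) hYlim
  refine ⟨τ', hτ'p, ⟨isFull_of_exists_norm_charFun_ne_one fun t ht => ?_, Ω, _, P, _, X,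
    fun n => A (q n), fun n => b (q n), hX,
    tendstoInDistribution_id_of_tendsto_charFun hY fun t => (hτ' t).symm ▸ hYlim t⟩, hτ'⟩
  obtain ⟨u, hu⟩ := hfull.exists_re_pos hτ ht
  refine ⟨u, ?_⟩
  have h1 : charFun τ' (u • t) = _ := hτ' (u • t)
  rw [h1, Complex.norm_exp, Complex.neg_re, Complex.re_ofReal_mul]
  exact (Real.exp_lt_one_iff.2 (by have := mul_pos hs hu; linarith)).ne

variable {ν : Measure ℝ} [IsProbabilityMeasure ν] {ρ : Measure (EuclideanSpace ℝ (Fin d))}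

theorem isOperatorPhiStable_of_charFun_eq (hν : ν (Set.Iic 0) = 0) (h : IsOperatorStable τ)
    (hψ : Continuous ψ) (hψ0 : ψ 0 = 0) (hτ : ∀ t, charFun τ t = Complex.exp (-ψ t)) {c : ℝ}
    (hc : 0 < c) [IsProbabilityMeasure ρ] (hρ : ∀ t, charFun ρ t = laplace ν ((c : ℂ) * ψ t)) :
    IsOperatorPhiStable ν ρ := by
  obtain ⟨τ', hτ'p, hτ's, hτ'⟩ := h.exists_charFun_eq_exp hψ hψ0 hτ hc
  refine ⟨isFull_of_exists_norm_charFun_ne_one fun t ht => ?_, τ', hτ'p, fun t => c * ψ t, hτ's,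
    by fun_prop, by simp [hψ0], hτ', hρ⟩
  obtain ⟨u, hu⟩ := h.1.exists_re_pos hτ ht
  refine ⟨u, ?_⟩
  rw [hρ]
  exact (norm_laplace_lt_one hν (by rw [Complex.re_ofReal_mul]; positivity)).ne

end OperatorStable

section RandomSumLimits

variable {d : ℕ} {ν : Measure ℝ} [IsProbabilityMeasure ν] {j k : ℕ}
  {μ κ lam : ℕ → ProbabilityMeasure (EuclideanSpace ℝ (Fin d))} {θ : ℕ → ℝ} {m : ℕ → ℕ}
  {τ : Measure (EuclideanSpace ℝ (Fin d))} [hτp : IsProbabilityMeasure τ]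
  {ψ : EuclideanSpace ℝ (Fin d) → ℂ}

/-- If `1 / (θ m) → c`, the random sums converge to the law with characteristic function
`φ(c k ψ)`. Here and below `μ n`, `κ n` and `lam n` are the laws of the summands, of the sums of
`m n` of them, and of the random sums. The case `c = 0` is allowed and gives the limit `1`. -/
theorem tendsto_charFun_of_tendsto_inv_mul (hν : ν (Set.Iic 0) = 0) (hθ : ∀ n, 0 < θ n)
    (hκ : ∀ n t, charFun (κ n : Measure (EuclideanSpace ℝ (Fin d))) t
      = charFun (μ n : Measure (EuclideanSpace ℝ (Fin d))) t ^ m n)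
    (hlam : ∀ n t, charFun (lam n : Measure (EuclideanSpace ℝ (Fin d))) t
      = charFun (μ n : Measure (EuclideanSpace ℝ (Fin d))) t ^ j *
        laplace ν ((1 - charFun (μ n : Measure (EuclideanSpace ℝ (Fin d))) t ^ k) / (θ n : ℂ)))
    (hlim : Tendsto κ atTop (𝓝 ⟨τ, hτp⟩)) (hψ : Continuous ψ) (hψ0 : ψ 0 = 0)
    (hτ : ∀ t, charFun τ t = Complex.exp (-ψ t)) (hm : Tendsto m atTop atTop) {c : ℝ}
    (hc : Tendsto (fun n => (θ n * m n)⁻¹) atTop (𝓝 c)) (t : EuclideanSpace ℝ (Fin d)) :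
    Tendsto (fun n => charFun (lam n : Measure (EuclideanSpace ℝ (Fin d))) t) atTop
      (𝓝 (laplace ν (((c * k : ℝ) : ℂ) * ψ t))) := by
  refine (tendsto_pow_mul_laplace hν j k (fun n => norm_charFun_le_one t)
    (Eventually.of_forall hθ) (tendsto_natCast_atTop_atTop.comp hm) ?_ hc).congr
    fun n => (hlam n t).symm
  simpa using tendsto_mul_one_sub_charFun hκ hm hlim hψ hψ0 hτ t

theorem tendsto_atTop_of_le_mul (hθ : ∀ n, 0 < θ n) (hθ0 : Tendsto θ atTop (𝓝 0)) {ε : ℝ}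
    (hε : 0 < ε) (h : ∀ᶠ n in atTop, ε ≤ θ n * m n) : Tendsto m atTop atTop := by
  have h1 : Tendsto (fun n => ε * (θ n)⁻¹) atTop atTop :=
    (tendsto_inv_nhdsGT_zero.comp (tendsto_nhdsWithin_iff.2
      ⟨hθ0, Eventually.of_forall hθ⟩)).const_mul_atTop hε
  refine (tendsto_natCast_atTop_iff (R := ℝ)).1 (tendsto_atTop_mono' _ ?_ h1)
  filter_upwards [h] with n hn
  rw [← div_eq_mul_inv, div_le_iff₀ (hθ n), mul_comm]
  exact hn

/-- Random sums with `θ m → c ∈ (0, ∞)` converge, to an operator `φ`-stable law. -/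
theorem exists_tendsto_and_isOperatorPhiStable (hν : ν (Set.Iic 0) = 0) (hk : 1 ≤ k)
    (hθ : ∀ n, 0 < θ n) (hθ0 : Tendsto θ atTop (𝓝 0))
    (hκ : ∀ n t, charFun (κ n : Measure (EuclideanSpace ℝ (Fin d))) t
      = charFun (μ n : Measure (EuclideanSpace ℝ (Fin d))) t ^ m n)
    (hlam : ∀ n t, charFun (lam n : Measure (EuclideanSpace ℝ (Fin d))) t
      = charFun (μ n : Measure (EuclideanSpace ℝ (Fin d))) t ^ j *
        laplace ν ((1 - charFun (μ n : Measure (EuclideanSpace ℝ (Fin d))) t ^ k) / (θ n : ℂ)))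
    (hlim : Tendsto κ atTop (𝓝 ⟨τ, hτp⟩)) (hτs : IsOperatorStable τ) {c : ℝ} (hc : 0 < c)
    (hθm : Tendsto (fun n => θ n * (m n : ℝ)) atTop (𝓝 c)) :
    ∃ ρ : ProbabilityMeasure (EuclideanSpace ℝ (Fin d)),
      Tendsto lam atTop (𝓝 ρ) ∧ IsOperatorPhiStable ν (ρ : Measure (EuclideanSpace ℝ (Fin d))) := by
  obtain ⟨ψ, hψ, hψ0, hτ⟩ := hτs.exists_continuous_log
  have hm : Tendsto m atTop atTop := tendsto_atTop_of_le_mul hθ hθ0 (half_pos hc)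
    ((hθm.eventually_const_lt (half_lt_self hc)).mono fun n hn => hn.le)
  have hk0 : (0 : ℝ) < k := by exact_mod_cast hk
  have hconv := tendsto_charFun_of_tendsto_inv_mul hν hθ hκ hlam hlim hψ hψ0 hτ hm
    (hθm.inv₀ hc.ne')
  have hcont : ContinuousAt (fun t => laplace ν (((c⁻¹ * k : ℝ) : ℂ) * ψ t)) 0 := by
    refine tendsto_laplace hν ((continuous_const.mul hψ).tendsto 0) (Eventually.of_forall fun t => ?_)
    rw [Complex.re_ofReal_mul]
    exact mul_nonneg (by positivity) (re_nonneg_of_charFun_eq_exp_neg hτ t)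
  obtain ⟨ρ, hρ⟩ := exists_charFun_eq_of_tendsto hcont hconv
  exact ⟨ρ, ProbabilityMeasure.tendsto_of_tendsto_charFun fun t => (hρ t).symm ▸ hconv t,
    isOperatorPhiStable_of_charFun_eq hν hτs hψ hψ0 hτ (by positivity) hρ⟩

/-- A limit law of the random sums other than the unit mass at the origin forces the numbers
`θ n * m n` to have a positive finite limit point. Along a subsequence on which `θ n * m n → 0`, the
limit `ω` of `κ n` would have `|ω| = 1` near the origin, against fullness; along a subsequence on
which `θ n * m n → ∞`, the random sums tend to `0`. -/
theorem isOperatorPhiStable_of_tendsto (hd : 1 ≤ d) (hν : ν (Set.Iic 0) = 0) (hk : 1 ≤ k)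
    (hθ : ∀ n, 0 < θ n) (hθ0 : Tendsto θ atTop (𝓝 0))
    (hκ : ∀ n t, charFun (κ n : Measure (EuclideanSpace ℝ (Fin d))) t
      = charFun (μ n : Measure (EuclideanSpace ℝ (Fin d))) t ^ m n)
    (hlam : ∀ n t, charFun (lam n : Measure (EuclideanSpace ℝ (Fin d))) t
      = charFun (μ n : Measure (EuclideanSpace ℝ (Fin d))) t ^ j *
        laplace ν ((1 - charFun (μ n : Measure (EuclideanSpace ℝ (Fin d))) t ^ k) / (θ n : ℂ)))
    (hlim : Tendsto κ atTop (𝓝 ⟨τ, hτp⟩)) (hτs : IsOperatorStable τ)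
    {ρ : ProbabilityMeasure (EuclideanSpace ℝ (Fin d))} (hρ : Tendsto lam atTop (𝓝 ρ))
    (hρ0 : (ρ : Measure (EuclideanSpace ℝ (Fin d))) ≠ Measure.dirac 0) :
    IsOperatorPhiStable ν (ρ : Measure (EuclideanSpace ℝ (Fin d))) := by
  obtain ⟨ψ, hψ, hψ0, hτ⟩ := hτs.exists_continuous_log
  have hk0 : (0 : ℝ) < k := by exact_mod_cast hk
  by_cases hbd : ∃ ε > 0, ∀ᶠ n in atTop, ε ≤ θ n * m n
  · obtain ⟨ε, hε, hbd⟩ := hbd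
    have hm : Tendsto m atTop atTop := tendsto_atTop_of_le_mul hθ hθ0 hε hbd
    have hmem : ∃ᶠ n in atTop, (θ n * m n)⁻¹ ∈ Set.Icc 0 ε⁻¹ :=
      (hbd.mono fun n hn => ⟨inv_nonneg.2 (hε.le.trans hn), inv_anti₀ hε hn⟩).frequently
    obtain ⟨c, hc, σ, hσ, hcσ⟩ := isCompact_Icc.tendsto_subseq' hmem
    have hconv (t : EuclideanSpace ℝ (Fin d)) :=
      tendsto_charFun_of_tendsto_inv_mul (μ := μ ∘ σ) (κ := κ ∘ σ) (lam := lam ∘ σ) (θ := θ ∘ σ)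
        (m := m ∘ σ) hν (fun n => hθ _) (fun n => hκ _) (fun n => hlam _)
        (hlim.comp hσ.tendsto_atTop) hψ hψ0 hτ (hm.comp hσ.tendsto_atTop) hcσ t
    have hρeq (t : EuclideanSpace ℝ (Fin d)) :
        charFun (ρ : Measure (EuclideanSpace ℝ (Fin d))) t = laplace ν (((c * k : ℝ) : ℂ) * ψ t) :=
      tendsto_nhds_unique (tendsto_charFun_of_tendsto (hρ.comp hσ.tendsto_atTop) t) (hconv t)
    rcases hc.1.eq_or_lt with h0 | hpos
    · refine absurd (Measure.ext_of_charFun (funext fun t => ?_)) hρ0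
      rw [hρeq, ← h0, charFun_dirac]
      simp [laplace_zero]
    · exact isOperatorPhiStable_of_charFun_eq hν hτs hψ hψ0 hτ (by positivity) hρeq
  · exfalso
    push Not at hbd
    obtain ⟨σ, hσ, hσlt⟩ := extraction_forall_of_frequently
      (P := fun n i => θ i * m i < 1 / ((n : ℝ) + 1)) fun n =>
        (hbd (1 / ((n : ℝ) + 1)) (by positivity))
    have hσ0 : Tendsto (fun n => θ (σ n) * (m (σ n) : ℝ)) atTop (𝓝 0) :=
      squeeze_zero (fun n => mul_nonneg (hθ _).le (Nat.cast_nonneg _)) (fun n => (hσlt n).le)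
        tendsto_one_div_add_atTop_nhds_zero_nat
    have hρcont : Continuous (charFun (ρ : Measure (EuclideanSpace ℝ (Fin d)))) := continuous_charFun
    -- `charFun ρ` is nonzero near the origin, and there `|charFun τ| = 1`.
    have hone : ∀ᶠ t in 𝓝 0, ‖charFun τ t‖ = 1 := by
      filter_upwards [hρcont.continuousAt.eventually_ne (by simp : charFun
        (ρ : Measure (EuclideanSpace ℝ (Fin d))) 0 ≠ 0)] with t ht
      refine norm_eq_one_of_tendsto_pow_of_tendsto_mul_zero hν j hk
        (f := fun n => charFun (μ (σ n) : Measure (EuclideanSpace ℝ (Fin d))) t)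
        (fun n => norm_charFun_le_one t) (fun n => hθ _) hσ0 ?_ ht ?_
      · exact ((tendsto_charFun_of_tendsto hlim t).comp hσ.tendsto_atTop).congr fun n => hκ _ t
      · exact ((tendsto_charFun_of_tendsto hρ t).comp hσ.tendsto_atTop).congr fun n => hlam _ t
    have : Nonempty (Fin d) := ⟨⟨0, hd⟩⟩
    obtain ⟨t, ht⟩ := exists_ne (0 : EuclideanSpace ℝ (Fin d))
    obtain ⟨u, hu⟩ := hτs.1.exists_norm_charFun_ne_one ht
    exact hu (norm_charFun_eq_one_of_eventually τ hone _)

end RandomSumLimits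

/-! ### Realization of operator `φ`-stable laws -/

section Realization

variable {d : ℕ} {Ω Ω' : Type*} [MeasurableSpace Ω] [MeasurableSpace Ω'] {P : Measure Ω}
  [IsProbabilityMeasure P] {P' : Measure Ω'} {X : ℕ → Ω → EuclideanSpace ℝ (Fin d)}

theorem IsIID.comp_measurePreserving (hX : IsIID P X) [IsProbabilityMeasure P'] {g : Ω' → Ω}
    (hg : MeasurePreserving g P' P) : IsIID P' fun i ω => X i (g ω) := by
  have hmap (i : ℕ) : P'.map (fun ω => X i (g ω)) = P.map (X i) := by
    rw [← hg.map_eq, Measure.map_map (hX.measurable i) hg.measurable]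
    rfl
  have hmeas (i : ℕ) : Measurable fun ω => X i (g ω) := (hX.measurable i).comp hg.measurable
  refine ⟨hmeas, ?_, fun i => ⟨(hmeas i).aemeasurable, (hmeas 0).aemeasurable, ?_⟩⟩
  · rw [iIndepFun_iff_map_fun_eq_infinitePi_map hmeas]
    simp only [hmap]
    rw [← (iIndepFun_iff_map_fun_eq_infinitePi_map hX.measurable).1 hX.indep, ← hg.map_eq,
      Measure.map_map (measurable_pi_lambda _ hX.measurable) hg.measurable]
    rfl
  · rw [hmap, hmap, (hX.ident i).map_eq]

theorem tendsto_inv_mul_ceil_div {a : ℝ} (ha : 0 < a) :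
    Tendsto (fun θ : ℝ => (θ * (⌈a / θ⌉₊ : ℝ))⁻¹) (𝓝[>] 0) (𝓝 a⁻¹) := by
  have h1 := ((tendsto_nat_ceil_mul_div_atTop ha.le).comp
    (tendsto_inv_nhdsGT_zero (𝕜 := ℝ))).inv₀ ha.ne'
  refine h1.congr fun θ => ?_
  simp [div_eq_mul_inv, mul_comm]

end Realization

/-- An operator `φ`-stable law is a limit of normed random sums: take `X`, `A` and `b` from the
operator stable law behind it, normalize the `N_θ`-sum with index `⌈k / θ⌉`, and let `N_θ` be the
coordinates of an infinite product, independent of `X`. The joint law of the `N_θ` is immaterial. -/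
theorem exists_randomSum_tendsto {d : ℕ} {ν : Measure ℝ} [IsProbabilityMeasure ν]
    (hν : ν (Set.Iic 0) = 0) (j : ℕ) {k : ℕ} (hk : 1 ≤ k)
    {ρ : Measure (EuclideanSpace ℝ (Fin d))} [IsProbabilityMeasure ρ]
    (h : IsOperatorPhiStable ν ρ) :
    ∃ (Ω : Type) (_ : MeasurableSpace Ω) (P : Measure Ω) (_ : IsProbabilityMeasure P)
      (X : ℕ → Ω → EuclideanSpace ℝ (Fin d)) (N : ℝ → Ω → ℕ)
      (A : ℝ → EuclideanSpace ℝ (Fin d) →L[ℝ] EuclideanSpace ℝ (Fin d))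
      (b : ℝ → EuclideanSpace ℝ (Fin d)),
      IsIID P X ∧
      (∀ θ, Measurable (N θ)) ∧
      (∀ θ, 0 < θ → IndepFun (N θ) (fun ω i => X i ω) P) ∧
      (∀ θ, 0 < θ → HasPhiPGF ν j k θ P (N θ)) ∧
      TendstoInDistribution
        (fun (θ : ℝ) => randomSum (fun i ω => A θ (X i ω - b θ)) (N θ))
        (𝓝[>] 0) (fun y : EuclideanSpace ℝ (Fin d) => y) (fun _ => P) ρ := by
  obtain ⟨-, τ, _, ψ, ⟨-, Ω, _, P, _, X, A, b, hX, hlim⟩, hψ, hψ0, hτ, hρ⟩ := h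
  have hlaw (θ : ℝ) : ∃ κ : Measure ℕ, IsProbabilityMeasure κ ∧ (0 < θ → HasPhiPGF ν j k θ κ id) := by
    by_cases hθ : 0 < θ
    · obtain ⟨κ, h1, h2⟩ := exists_hasPhiPGF hν j k hθ
      exact ⟨κ, h1, fun _ => h2⟩
    -- Nothing is asked of `N_θ` for `θ ≤ 0`.
    · exact ⟨Measure.dirac 0, inferInstance, fun h => absurd h hθ⟩
  choose κ hκp hκ using hlaw
  set Q : Measure (Ω × (ℝ → ℕ)) := P.prod (Measure.infinitePi κ)
  have hfst : MeasurePreserving Prod.fst Q P := measurePreserving_fst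
  have hX' : IsIID Q fun i ω => X i ω.1 := hX.comp_measurePreserving hfst
  have hN (θ : ℝ) : MeasurePreserving (fun ω : Ω × (ℝ → ℕ) => ω.2 θ) Q (κ θ) :=
    (measurePreserving_eval_infinitePi κ θ).comp measurePreserving_snd
  have hind (θ : ℝ) : IndepFun (fun ω : Ω × (ℝ → ℕ) => ω.2 θ) (fun ω i => X i ω.1) Q :=
    (indepFun_prod (measurable_pi_lambda _ hX.measurable) (measurable_pi_apply θ)).symm
  have hpgf (θ : ℝ) (hθ : 0 < θ) : HasPhiPGF ν j k θ Q fun ω => ω.2 θ := fun s hs0 hs1 => by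
    rw [← hκ θ hθ s hs0 hs1, ← (hN θ).map_eq,
      integral_map (hN θ).measurable.aemeasurable (by fun_prop)]
    rfl
  set q : ℝ → ℕ := fun θ => ⌈(k : ℝ) / θ⌉₊
  have hk0 : (0 : ℝ) < k := by exact_mod_cast hk
  have hq : Tendsto q (𝓝[>] 0) atTop :=
    tendsto_nat_ceil_atTop.comp (tendsto_inv_nhdsGT_zero.const_mul_atTop hk0)
  have haff (θ : ℝ) := hX'.affine (A (q θ)) (b (q θ))
  refine ⟨Ω × (ℝ → ℕ), inferInstance, Q, inferInstance, fun i ω => X i ω.1, fun θ ω => ω.2 θ,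
    fun θ => A (q θ), fun θ => b (q θ), hX', fun θ => (hN θ).measurable, fun θ _ => hind θ, hpgf,
    tendstoInDistribution_id_of_tendsto_charFun
      (fun θ => ((haff θ).measurable_randomSum (hN θ).measurable).aemeasurable) fun t => ?_⟩
  set f : ℝ → ℂ := fun θ => charFun (P.map fun ω => A (q θ) (X 0 ω - b (q θ))) t
  have hf (θ : ℝ) : ‖f θ‖ ≤ 1 := by
    have := Measure.isProbabilityMeasure_map (μ := P)
      ((hX.affine (A (q θ)) (b (q θ))).measurable 0).aemeasurable
    exact norm_charFun_le_one t
  -- `θ * ⌈k / θ⌉ → k` makes the constant `c k` in the limit equal to `1`.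
  have hmain := tendsto_pow_mul_laplace (l := 𝓝[>] (0 : ℝ)) (θ := id) hν j k hf eventually_mem_nhdsWithin
    (tendsto_natCast_atTop_atTop.comp hq)
    (by simpa only [f, Function.comp_def, Complex.ofReal_natCast] using
      (hX.tendsto_mul_one_sub_charFun_of_norming hlim hψ hψ0 hτ t).comp hq)
    (tendsto_inv_mul_ceil_div hk0)
  rw [inv_mul_cancel₀ hk0.ne', Complex.ofReal_one, one_mul, ← hρ] at hmain
  refine hmain.congr' ?_
  filter_upwards [eventually_mem_nhdsWithin] with θ hθ
  have hindA : IndepFun (fun ω : Ω × (ℝ → ℕ) => ω.2 θ)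
      (fun ω i => A (q θ) (X i ω.1 - b (q θ))) Q :=
    (hind θ).comp measurable_id
      (ψ := fun (x : ℕ → EuclideanSpace ℝ (Fin d)) i => A (q θ) (x i - b (q θ))) (by fun_prop)
  have hmap : Q.map (fun ω => A (q θ) (X 0 ω.1 - b (q θ)))
      = P.map fun ω => A (q θ) (X 0 ω - b (q θ)) := by
    rw [← hfst.map_eq, Measure.map_map ((hX.affine _ _).measurable 0) hfst.measurable]
    rfl
  rw [(haff θ).charFun_randomSum (hN θ).measurable hindA, hmap,
    (hpgf θ hθ).integral_pow hν hk hθ (hN θ).measurable (hf θ)]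
  rfl


/-! ### Limit laws of random sums are the operator `φ`-stable laws -/

theorem theorem8 (d : ℕ) (hd : 1 ≤ d)
    (ν : Measure ℝ) [IsProbabilityMeasure ν] (hν : ν (Set.Iic 0) = 0)
    (j k : ℕ) (hk : 1 ≤ k) :
    -- limit laws of `N_θ`-sums are operator `φ`-stable
    (∀ (θ : ℕ → ℝ) (m : ℕ → ℕ) (Ω : ℕ → Type*) [∀ n, MeasurableSpace (Ω n)]
        (P : ∀ n, Measure (Ω n)) [∀ n, IsProbabilityMeasure (P n)]
        (X : ∀ n, ℕ → Ω n → EuclideanSpace ℝ (Fin d)) (N : ∀ n, Ω n → ℕ)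
        (τ : Measure (EuclideanSpace ℝ (Fin d))) [IsProbabilityMeasure τ],
      (∀ n, 0 < θ n) → Tendsto θ atTop (𝓝 0) →
      (∀ n, IsIID (P n) (X n)) →
      (∀ n, Measurable (N n)) →
      (∀ n, IndepFun (N n) (fun ω i => X n i ω) (P n)) →
      (∀ n, HasPhiPGF ν j k (θ n) (P n) (N n)) →
      IsOperatorStable τ →
      TendstoInDistribution (fun n ω => ∑ i ∈ Finset.range (m n), X n i ω) atTop
        (fun y : EuclideanSpace ℝ (Fin d) => y) P τ →
      (∀ (ρ : Measure (EuclideanSpace ℝ (Fin d))) [IsProbabilityMeasure ρ],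
        TendstoInDistribution (fun n => randomSum (X n) (N n)) atTop
          (fun y : EuclideanSpace ℝ (Fin d) => y) P ρ →
        ρ ≠ Measure.dirac 0 → IsOperatorPhiStable ν ρ) ∧
      (∀ c : ℝ, 0 < c → Tendsto (fun n => θ n * (m n : ℝ)) atTop (𝓝 c) →
        ∃ (ρ : Measure (EuclideanSpace ℝ (Fin d))) (_ : IsProbabilityMeasure ρ),
          TendstoInDistribution (fun n => randomSum (X n) (N n)) atTop
            (fun y : EuclideanSpace ℝ (Fin d) => y) P ρ ∧
          IsOperatorPhiStable ν ρ)) ∧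
    -- every operator `φ`-stable law is such a limit, for each member of the class
    (∀ (ρ : Measure (EuclideanSpace ℝ (Fin d))) [IsProbabilityMeasure ρ],
      IsOperatorPhiStable ν ρ →
      ∃ (Ω : Type) (_ : MeasurableSpace Ω) (P : Measure Ω) (_ : IsProbabilityMeasure P)
        (X : ℕ → Ω → EuclideanSpace ℝ (Fin d)) (N : ℝ → Ω → ℕ)
        (A : ℝ → EuclideanSpace ℝ (Fin d) →L[ℝ] EuclideanSpace ℝ (Fin d))
        (b : ℝ → EuclideanSpace ℝ (Fin d)),
        IsIID P X ∧
        (∀ θ, Measurable (N θ)) ∧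
        (∀ θ, 0 < θ → IndepFun (N θ) (fun ω i => X i ω) P) ∧
        (∀ θ, 0 < θ → HasPhiPGF ν j k θ P (N θ)) ∧
        TendstoInDistribution
          (fun (θ : ℝ) => randomSum (fun i ω => A θ (X i ω - b θ)) (N θ))
          (𝓝[>] 0) (fun y : EuclideanSpace ℝ (Fin d) => y) (fun _ => P) ρ) := by
  refine ⟨?_, fun ρ _ h => exists_randomSum_tendsto hν j hk h⟩
  intro θ m Ω _ P _ X N τ _ hθ hθ0 hX hN hind hpgf hτs hlim
  have hS (n : ℕ) : AEMeasurable (randomSum (X n) (N n)) (P n) :=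
    ((hX n).measurable_randomSum (hN n)).aemeasurable
  set μ : ℕ → ProbabilityMeasure (EuclideanSpace ℝ (Fin d)) := fun n =>
    ⟨(P n).map (X n 0), Measure.isProbabilityMeasure_map ((hX n).measurable 0).aemeasurable⟩
  set lam : ℕ → ProbabilityMeasure (EuclideanSpace ℝ (Fin d)) := fun n =>
    ⟨(P n).map (randomSum (X n) (N n)), Measure.isProbabilityMeasure_map (hS n)⟩
  have hlam (n : ℕ) (t : EuclideanSpace ℝ (Fin d)) :
      charFun (lam n : Measure (EuclideanSpace ℝ (Fin d))) t
        = charFun (μ n : Measure (EuclideanSpace ℝ (Fin d))) t ^ j *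
          laplace ν ((1 - charFun (μ n : Measure (EuclideanSpace ℝ (Fin d))) t ^ k) / (θ n : ℂ)) :=
    ((hX n).charFun_randomSum (hN n) (hind n) t).trans
      ((hpgf n).integral_pow hν hk (hθ n) (hN n) (norm_charFun_le_one (μ := (μ n : Measure _)) t))
  set κ : ℕ → ProbabilityMeasure (EuclideanSpace ℝ (Fin d)) := fun n =>
    ⟨(P n).map fun ω => ∑ i ∈ Finset.range (m n), X n i ω,
      Measure.isProbabilityMeasure_map (hlim.forall_aemeasurable n)⟩
  have hκ (n : ℕ) (t : EuclideanSpace ℝ (Fin d)) :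
      charFun (κ n : Measure (EuclideanSpace ℝ (Fin d))) t
        = charFun (μ n : Measure (EuclideanSpace ℝ (Fin d))) t ^ m n :=
    (hX n).charFun_sum (m n) t
  have hκlim := (tendstoInDistribution_id_iff hlim.forall_aemeasurable).1 hlim
  refine ⟨fun ρ hρp hρ hρ0 => ?_, fun c hc hθm => ?_⟩
  · exact isOperatorPhiStable_of_tendsto (μ := μ) (κ := κ) (lam := lam) (ρ := ⟨ρ, hρp⟩) hd hν hk hθ hθ0 hκ
      hlam hκlim hτs ((tendstoInDistribution_id_iff hS).1 hρ) hρ0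
  · obtain ⟨⟨ρ, hρp⟩, hρ, hρs⟩ := exists_tendsto_and_isOperatorPhiStable (μ := μ) (κ := κ) (lam := lam)
      hν hk hθ hθ0 hκ hlam hκlim hτs hc hθm
    exact ⟨ρ, hρp, (tendstoInDistribution_id_iff hS).2 hρ, hρs⟩
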